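/- Let $H$ be an infinite-dimensional complex Hilbert space. Let $\dim$ denote Hilbert-space dimension (the cardinality of an orthonormal basis), let $B(H)$ be the space of bounded linear operators on $H$ with the norm topology, and for $A\in B(H)$ let $N(A)$ and $R(A)$ be its kernel and range. For a linear subspace $E\subseteq H$ put $$IC(E)=\min\{\dim(\overline{E}\ominus V) : V \text{ is a complete linear subspace of } E\},$$ and for $A\in B(H)$ define the cardinals $$\iota_i(A)=\dim N(A)+IC(R(A)),\qquad \iota_f(A)=\dim\bigl(H\ominus\overline{R(A)}\bigr)+IC(R(A)),\qquad \iota_m(A)=\min(\iota_i(A),\iota_f(A)).$$ For cardinals $\alpha,\beta$ such that $\alpha=\beta<\aleph_0$ or $\alpha\neq\beta$, let $\alpha-\beta$ be the integer difference if both are finite; otherwise let $\alpha-\beta=\alpha$ if $\alpha>\beta$, and $\alpha-\beta=-\beta$ (the negative of the cardinal $\beta$) if $\alpha<\beta$. For $\alpha=\beta\ge\aleph_0$ the difference is undefined. Put $|\alpha|=|-\alpha|=\alpha$ for every cardinal $\alpha$. The index of $A\in B(H)$ is $\operatorname{ind}(A)=\iota_i(A)-\iota_f(A)$; it is undefined exactly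 when $\iota_i(A)=\iota_f(A)\ge\aleph_0$. For $\gamma$ a cardinal or the negative of a cardinal, let $\operatorname{Ind}_\gamma(H)$ be the set of all $A\in B(H)$ whose index is defined and equal to $\gamma$. **Theorem.** For every $\gamma$ with $|\gamma|\le\dim H$, the set $\operatorname{Ind}_\gamma(H)$ is connected and open in $B(H)$, and it coincides with the interior of its closure. The boundary of $\operatorname{Ind}_\gamma(H)$ is connected as well, and it consists precisely of those $A\in B(H)$ whose index is undefined and which satisfy $\iota_m(A)\ge|\gamma|$. -/

import Mathlib

universe u

namespace HilbertIndex

open Cardinal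

/-- Any two Hilbert bases of a space have the same cardinality (one inequality). -/
theorem mk_le_of_hilbertBasis {E : Type u} [NormedAddCommGroup E] [InnerProductSpace ℂ E]
    {ι κ : Type u} (b : HilbertBasis ι ℂ E) (c : HilbertBasis κ ℂ E) : #κ ≤ #ι := by
  classical
  rcases finite_or_infinite ι with hι | hι
  · have : Fintype ι := Fintype.ofFinite ι
    have B : Module.Basis ι ℂ E := b.toOrthonormalBasis.toBasis
    have h := (c.orthonormal.linearIndependent).cardinal_le_rank
    rwa [← B.mk_eq_rank''] at h
  · have hc : ∀ i, {k : κ | inner ℂ (c k) (b i) ≠ 0}.Countable := by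
      intro i
      have hs := c.orthonormal.inner_products_summable (b i)
      refine hs.countable_support.mono ?_
      intro k hk
      simpa using hk
    have hcov : (⋃ i, {k : κ | inner ℂ (c k) (b i) ≠ 0}) = Set.univ := by
      refine Set.eq_univ_of_forall fun k => ?_
      by_contra hk
      have h0 : ∀ i, b.repr (c k) i = 0 := by
        intro i
        rw [b.repr_apply_apply]
        by_contra hne
        refine hk (Set.mem_iUnion.2 ⟨i, ?_⟩)
        intro h
        exact hne (inner_eq_zero_symm.1 h)
      have : b.repr (c k) = 0 := by
        ext i
        exact h0 i
      have : c k = 0 := by simpa using this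
      exact c.orthonormal.ne_zero k this
    calc #κ = #(Set.univ : Set κ) := mk_univ.symm
      _ = #(⋃ i, {k : κ | inner ℂ (c k) (b i) ≠ 0} : Set κ) := by rw [hcov]
      _ ≤ #ι * ⨆ i, #({k : κ | inner ℂ (c k) (b i) ≠ 0} : Set κ) := mk_iUnion_le _
      _ ≤ #ι * ℵ₀ := by
          gcongr
          exact ciSup_le' fun i => le_aleph0_iff_set_countable.2 (hc i)
      _ = #ι := mul_aleph0_eq (infinite_iff.1 hι)

/-- The Hilbert-space dimension of `E`: the cardinality of its orthonormal (Hilbert) bases. -/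
noncomputable def hilbertDim (E : Type u) [NormedAddCommGroup E] [InnerProductSpace ℂ E] :
    Cardinal.{u} :=
  sInf {c | ∃ ι : Type u, #ι = c ∧ Nonempty (HilbertBasis ι ℂ E)}

/-- The dimension is the cardinality of any Hilbert basis. -/
theorem hilbertDim_eq {E : Type u} [NormedAddCommGroup E] [InnerProductSpace ℂ E]
    {ι : Type u} (b : HilbertBasis ι ℂ E) : hilbertDim E = #ι := by
  refine le_antisymm (csInf_le' ⟨ι, rfl, ⟨b⟩⟩) ?_
  refine le_csInf ⟨_, ι, rfl, ⟨b⟩⟩ ?_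
  rintro _ ⟨κ, rfl, ⟨c⟩⟩
  exact mk_le_of_hilbertBasis c b

section Operators

variable {H K : Type u} [NormedAddCommGroup H] [InnerProductSpace ℂ H]
  [NormedAddCommGroup K] [InnerProductSpace ℂ K]

/-- The index of incompleteness `IC(E)` of a linear subspace `E` of a Hilbert space `K`: the least
of the dimensions of `Ē ⊖ V`, where `V` runs over the complete subspaces of `E`. The completion `Ē`
of `E` is its closure in `K`. -/
noncomputable def incompletenessIndex (E : Submodule ℂ K) : Cardinal.{u} :=
  sInf {c | ∃ V : Submodule ℂ K, V ≤ E ∧ IsComplete (V : Set K) ∧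
    hilbertDim ↥(E.topologicalClosure ⊓ Vᗮ) = c}

/-- The initial index `ι_i(A) = dim N(A) + IC(R(A))`. -/
noncomputable def initialIndex (A : H →L[ℂ] K) : Cardinal.{u} :=
  hilbertDim ↥(A : H →ₗ[ℂ] K).ker + incompletenessIndex (A : H →ₗ[ℂ] K).range

/-- The final index `ι_f(A) = dim (K ⊖ closure of R(A)) + IC(R(A))`. -/
noncomputable def finalIndex (A : H →L[ℂ] K) : Cardinal.{u} :=
  hilbertDim ↥((A : H →ₗ[ℂ] K).range.topologicalClosureᗮ) +
    incompletenessIndex (A : H →ₗ[ℂ] K).range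

/-- `ι_m(A) = min (ι_i(A), ι_f(A))`. -/
noncomputable def minIndex (A : H →L[ℂ] K) : Cardinal.{u} :=
  min (initialIndex A) (finalIndex A)

end Operators

/-- A cardinal or the negative of a cardinal, given by its positive part and its negative part,
one of which vanishes (so that `-0 = 0`). -/
@[ext]
structure SignedCardinal : Type (u + 1) where
  posPart : Cardinal.{u}
  negPart : Cardinal.{u}
  eq_zero_or : posPart = 0 ∨ negPart = 0

namespace SignedCardinal

/-- The cardinal `c` as a signed cardinal. -/
def ofCardinal (c : Cardinal.{u}) : SignedCardinal.{u} := ⟨c, 0, Or.inr rfl⟩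

instance : Neg SignedCardinal.{u} := ⟨fun γ => ⟨γ.negPart, γ.posPart, γ.eq_zero_or.symm⟩⟩

/-- The integer `n` as a signed (finite) cardinal. -/
def ofInt (n : ℤ) : SignedCardinal.{u} :=
  if 0 ≤ n then ofCardinal (n.natAbs : Cardinal.{u}) else -ofCardinal (n.natAbs : Cardinal.{u})

/-- `|c| = |-c| = c` for every cardinal `c`. -/
def abs (γ : SignedCardinal.{u}) : Cardinal.{u} := γ.posPart + γ.negPart

end SignedCardinal

/-- The pairs `(α, β)` of cardinals for which `α - β` is defined: either `α = β < ℵ₀` or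
`α ≠ β`. -/
def DifferenceDefined (α β : Cardinal.{u}) : Prop := (α = β ∧ β < ℵ₀) ∨ α ≠ β

open Classical in
/-- The difference `α - β`, meaningful if `DifferenceDefined α β`: the integer difference if both
cardinals are finite, and otherwise `α` if `β < α` and `-β` if `α < β`. -/
noncomputable def difference (α β : Cardinal.{u}) : SignedCardinal.{u} :=
  if α < ℵ₀ ∧ β < ℵ₀ then SignedCardinal.ofInt ((toNat α : ℤ) - (toNat β : ℤ))
  else if β < α then SignedCardinal.ofCardinal α
  else -SignedCardinal.ofCardinal β

section Index

variable {H : Type u} [NormedAddCommGroup H] [InnerProductSpace ℂ H]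

/-- `ind(A)` is defined if the difference `ι_i(A) - ι_f(A)` is. -/
def IndexDefined (A : H →L[ℂ] H) : Prop := DifferenceDefined (initialIndex A) (finalIndex A)

/-- `ind(A) = ι_i(A) - ι_f(A)`, meaningful if `IndexDefined A`. -/
noncomputable def index (A : H →L[ℂ] H) : SignedCardinal.{u} :=
  difference (initialIndex A) (finalIndex A)

variable (H)

/-- The set of all operators on `H` whose index is defined and equal to `γ`. -/
def Ind (γ : SignedCardinal.{u}) : Set (H →L[ℂ] H) := {A | IndexDefined A ∧ index A = γ}

/-- The set of all operators on `H` whose index is undefined. -/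
def Uind : Set (H →L[ℂ] H) := {A | ¬ IndexDefined A}

end Index

end HilbertIndex

/-! Everything rests on `HasCodims A a b`: `A` is bounded below on a closed subspace `V`, where `V`
and `A(V)` have codimensions `a` and `b`. Any such pair arises from the nullity and the corank of
`A` by adding one cardinal `d ≥ IC(R(A))` to both (`HasCodims.exists_eq_add`), and `d = IC(R(A))` is
attained (`hasCodims_indices`). So the two indices are the least codimensions, and whenever `a - b`
is defined it equals the index, since lowering a common summand does not affect a defined
difference. The same `V` serves all operators near `A`, with the same codimensions
(`HasCodims.eventually`); hence `Ind_γ` is open. The adjoint swaps the codimensions, so `γ ≥ 0` may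
be assumed. For connectedness, `A` is joined by a segment to an operator onto `H` with kernel of
dimension `γ` (`exists_surjective_modification`). Any two such operators differ by an invertible
right factor, and the invertible group is path connected (`joinedIn_one_of_isUnit`). If the index of
`A` is undefined, both indices equal some `α ≥ ℵ₀`. Cutting `A` off where it is small leaves
codimensions `α` and `α = α + |γ|` for every `|γ| ≤ α`, so a small perturbation has index `γ`. This
gives the boundary and the interior of the closure; the boundary is connected because it is
star-shaped about `0`. -/

namespace HilbertIndex

open Cardinal

/-! ### Hilbert-space dimension. -/

section Dimension

variable {E F : Type u} [NormedAddCommGroup E] [InnerProductSpace ℂ E]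
  [NormedAddCommGroup F] [InnerProductSpace ℂ F]

theorem exists_hilbertBasis_type (E : Type u) [NormedAddCommGroup E] [InnerProductSpace ℂ E]
    [CompleteSpace E] : ∃ ι : Type u, Nonempty (HilbertBasis ι ℂ E) :=
  let ⟨w, b, _⟩ := exists_hilbertBasis ℂ E
  ⟨w, ⟨b⟩⟩

/-- A bounded operator with dense range does not raise the dimension. -/
theorem hilbertDim_le_of_forall_inner_eq_zero [CompleteSpace E] [CompleteSpace F] (T : E →L[ℂ] F)
    (hT : ∀ z : F, (∀ y, inner ℂ z (T y) = 0) → z = 0) : hilbertDim F ≤ hilbertDim E := by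
  classical
  obtain ⟨ι, ⟨b⟩⟩ := exists_hilbertBasis_type E
  obtain ⟨κ, ⟨c⟩⟩ := exists_hilbertBasis_type F
  rw [hilbertDim_eq b, hilbertDim_eq c]
  rcases finite_or_infinite ι with hι | hι
  · have : Fintype ι := Fintype.ofFinite ι
    have B : Module.Basis ι ℂ E := b.toOrthonormalBasis.toBasis
    have hfin : FiniteDimensional ℂ E := B.finiteDimensional_of_finite
    have hrange : (T : E →ₗ[ℂ] F).range = ⊤ := by
      have : CompleteSpace (T : E →ₗ[ℂ] F).range := FiniteDimensional.complete ℂ _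
      rw [← Submodule.orthogonal_eq_bot_iff, Submodule.eq_bot_iff]
      intro z hz
      refine hT z fun y => ?_
      exact (Submodule.mem_orthogonal' _ _).1 hz _ ⟨y, rfl⟩
    have h1 := (c.orthonormal.linearIndependent).cardinal_le_rank
    have h2 := LinearMap.rank_le_of_surjective (T : E →ₗ[ℂ] F) (LinearMap.range_eq_top.1 hrange)
    rw [← B.mk_eq_rank''] at h2
    exact h1.trans h2
  -- Each `T (b i)` has countably many nonzero coefficients, and every `k` occurs for some `i`:
  -- otherwise `c k` would be orthogonal to the range of `T`.
  · have hc : ∀ i, {k : κ | inner ℂ (c k) (T (b i)) ≠ 0}.Countable := by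
      intro i
      have hs := c.orthonormal.inner_products_summable (T (b i))
      refine hs.countable_support.mono ?_
      intro k hk
      simpa using hk
    have hcov : (⋃ i, {k : κ | inner ℂ (c k) (T (b i)) ≠ 0}) = Set.univ := by
      refine Set.eq_univ_of_forall fun k => ?_
      by_contra hk
      have h0 : ∀ i, inner ℂ (c k) (T (b i)) = 0 := by
        intro i
        by_contra hne
        exact hk (Set.mem_iUnion.2 ⟨i, hne⟩)
      have h1 : ContinuousLinearMap.adjoint T (c k) = 0 := by
        have : b.repr (ContinuousLinearMap.adjoint T (c k)) = 0 := by
          ext i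
          rw [b.repr_apply_apply, ContinuousLinearMap.adjoint_inner_right]
          exact inner_eq_zero_symm.1 (h0 i)
        simpa using this
      refine c.orthonormal.ne_zero k (hT _ fun y => ?_)
      rw [← ContinuousLinearMap.adjoint_inner_left, h1, inner_zero_left]
    calc #κ = #(Set.univ : Set κ) := mk_univ.symm
      _ = #(⋃ i, {k : κ | inner ℂ (c k) (T (b i)) ≠ 0} : Set κ) := by rw [hcov]
      _ ≤ #ι * ⨆ i, #({k : κ | inner ℂ (c k) (T (b i)) ≠ 0} : Set κ) := mk_iUnion_le _
      _ ≤ #ι * ℵ₀ := by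
          gcongr
          exact ciSup_le' fun i => le_aleph0_iff_set_countable.2 (hc i)
      _ = #ι := mul_aleph0_eq (infinite_iff.1 hι)

/-- The adjoint of an injective operator has dense range. -/
theorem hilbertDim_le_of_injective [CompleteSpace E] [CompleteSpace F] (T : E →L[ℂ] F)
    (hT : ∀ x, T x = 0 → x = 0) : hilbertDim E ≤ hilbertDim F := by
  refine hilbertDim_le_of_forall_inner_eq_zero (ContinuousLinearMap.adjoint T) fun z hz => ?_
  refine hT z ?_
  have := hz (T z)
  rwa [ContinuousLinearMap.adjoint_inner_right, inner_self_eq_zero] at this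

theorem hilbertDim_eq_of_bijective [CompleteSpace E] [CompleteSpace F] (T : E →L[ℂ] F)
    (hT : Function.Bijective T) : hilbertDim E = hilbertDim F := by
  refine le_antisymm (hilbertDim_le_of_injective T fun x hx => hT.1 (by rw [hx, map_zero])) ?_
  refine hilbertDim_le_of_forall_inner_eq_zero T fun z hz => ?_
  obtain ⟨y, rfl⟩ := hT.2 z
  exact inner_self_eq_zero.1 (hz y)

/-- The orthogonal projection onto `X` is injective on `U`. Later comparisons of codimensions
thereby reduce to trivial intersections. -/
theorem hilbertDim_le_of_inf_orthogonal_eq_bot [CompleteSpace E] {U X : Submodule ℂ E}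
    (hU : IsClosed (U : Set E)) (hX : IsClosed (X : Set E)) (h : ∀ x ∈ U, x ∈ Xᗮ → x = 0) :
    hilbertDim U ≤ hilbertDim X := by
  have : CompleteSpace U := hU.completeSpace_coe
  have : CompleteSpace X := hX.completeSpace_coe
  refine hilbertDim_le_of_injective (X.orthogonalProjectionOnto ∘L U.subtypeL) fun x hx => ?_
  ext
  refine h x x.2 ?_
  simpa using hx

theorem hilbertDim_bot : hilbertDim (⊥ : Submodule ℂ E) = 0 := by
  have b : HilbertBasis PEmpty.{u + 1} ℂ (⊥ : Submodule ℂ E) :=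
    HilbertBasis.mkOfOrthogonalEqBot (v := PEmpty.elim)
      ⟨fun i => i.elim, fun i => i.elim⟩ (Subsingleton.elim _ _)
  rw [hilbertDim_eq b, mk_eq_zero]

theorem hilbertDim_prod [CompleteSpace E] [CompleteSpace F] :
    hilbertDim (WithLp 2 (E × F)) = hilbertDim E + hilbertDim F := by
  classical
  obtain ⟨ι, ⟨b⟩⟩ := exists_hilbertBasis_type E
  obtain ⟨κ, ⟨c⟩⟩ := exists_hilbertBasis_type F
  have b0 : ∀ x : E, (∀ i, inner ℂ (b i) x = 0) → x = 0 := fun x hx => by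
    have : b.repr x = 0 := by
      ext i
      rw [b.repr_apply_apply]
      exact hx i
    simpa using this
  have c0 : ∀ x : F, (∀ i, inner ℂ (c i) x = 0) → x = 0 := fun x hx => by
    have : c.repr x = 0 := by
      ext i
      rw [c.repr_apply_apply]
      exact hx i
    simpa using this
  let v : ι ⊕ κ → WithLp 2 (E × F) :=
    Sum.elim (fun i => WithLp.toLp 2 (b i, 0)) (fun j => WithLp.toLp 2 (0, c j))
  have hb := orthonormal_iff_ite.1 b.orthonormal
  have hc := orthonormal_iff_ite.1 c.orthonormal
  have hv : Orthonormal ℂ v := by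
    rw [orthonormal_iff_ite]
    rintro (i | i) (j | j)
    · simp [v, hb]
    · simp [v]
    · simp [v]
    · simp [v, hc]
  have B : HilbertBasis (ι ⊕ κ) ℂ (WithLp 2 (E × F)) := by
    refine HilbertBasis.mkOfOrthogonalEqBot hv ?_
    rw [Submodule.eq_bot_iff]
    intro x hx
    rw [Submodule.mem_orthogonal] at hx
    have h1 : x.fst = 0 := b0 _ fun i => by
      simpa [v] using hx _ (Submodule.subset_span ⟨Sum.inl i, rfl⟩)
    have h2 : x.snd = 0 := c0 _ fun i => by
      simpa [v] using hx _ (Submodule.subset_span ⟨Sum.inr i, rfl⟩)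
    exact WithLp.ofLp_injective 2 (Prod.ext h1 h2)
  rw [hilbertDim_eq B, hilbertDim_eq b, hilbertDim_eq c, mk_sum, lift_id, lift_id]

/-- The dimension of an internal orthogonal direct sum. -/
theorem hilbertDim_eq_add [CompleteSpace E] {K L M : Submodule ℂ E} (hK : IsClosed (K : Set E))
    (hL : IsClosed (L : Set E)) (hM : IsClosed (M : Set E)) (hKL : L ≤ Kᗮ) (h : K ⊔ L = M) :
    hilbertDim M = hilbertDim K + hilbertDim L := by
  have : CompleteSpace K := hK.completeSpace_coe
  have : CompleteSpace L := hL.completeSpace_coe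
  have : CompleteSpace M := hM.completeSpace_coe
  subst h
  rw [← hilbertDim_prod]
  symm
  let T₀ : WithLp 2 (K × L) →L[ℂ] E :=
    K.subtypeL ∘L WithLp.fstL 2 ℂ K L + L.subtypeL ∘L WithLp.sndL 2 ℂ K L
  have hT₀ : ∀ x, T₀ x = x.fst + x.snd := fun x => rfl
  let T : WithLp 2 (K × L) →L[ℂ] ↥(K ⊔ L) := T₀.codRestrict (K ⊔ L) fun x => by
    rw [hT₀]
    exact Submodule.add_mem_sup x.fst.2 x.snd.2
  refine hilbertDim_eq_of_bijective T ⟨?_, ?_⟩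
  · rw [injective_iff_map_eq_zero]
    intro x hx
    have hx : (x.fst : E) + x.snd = 0 := congrArg Subtype.val hx
    have h0 : inner ℂ (x.fst : E) (x.snd : E) = 0 :=
      (Submodule.mem_orthogonal _ _).1 (hKL x.snd.2) _ x.fst.2
    have h1 : (x.fst : E) = 0 := by
      rw [← inner_self_eq_zero (𝕜 := ℂ)]
      have := congrArg (inner ℂ (x.fst : E)) hx
      rwa [inner_add_right, h0, add_zero, inner_zero_right] at this
    have h2 : (x.snd : E) = 0 := by rwa [h1, zero_add] at hx
    exact WithLp.ofLp_injective 2 (Prod.ext (Subtype.ext h1) (Subtype.ext h2))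
  · rintro ⟨z, hz⟩
    obtain ⟨x, hx, y, hy, rfl⟩ := Submodule.mem_sup.1 hz
    exact ⟨WithLp.toLp 2 (⟨x, hx⟩, ⟨y, hy⟩), rfl⟩

theorem exists_linearIsometryEquiv [CompleteSpace E] [CompleteSpace F]
    (h : hilbertDim E = hilbertDim F) : Nonempty (E ≃ₗᵢ[ℂ] F) := by
  obtain ⟨ι, ⟨b⟩⟩ := exists_hilbertBasis_type E
  obtain ⟨κ, ⟨c⟩⟩ := exists_hilbertBasis_type F
  rw [hilbertDim_eq b, hilbertDim_eq c] at h
  obtain ⟨e⟩ := Cardinal.eq.1 h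
  have b' : HilbertBasis κ ℂ E := by
    refine HilbertBasis.mk (b.orthonormal.comp e.symm e.symm.injective) ?_
    rw [e.symm.surjective.range_comp, b.dense_span]
  exact ⟨b'.repr.trans c.repr.symm⟩

theorem exists_hilbertDim_eq (a : Cardinal.{u}) :
    ∃ (X : Type u) (_ : NormedAddCommGroup X) (_ : InnerProductSpace ℂ X) (_ : CompleteSpace X),
      hilbertDim X = a := by
  induction a using Cardinal.inductionOn with
  | _ ι =>
    exact ⟨lp (fun _ : ι => ℂ) 2, inferInstance, inferInstance, inferInstance,
      hilbertDim_eq (HilbertBasis.ofRepr (LinearIsometryEquiv.refl ℂ _))⟩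

/-- If `dim E = dim F + a`, some bounded operator maps `E` onto `F` with a kernel of
dimension `a`. -/
theorem exists_surjective_hilbertDim_ker [CompleteSpace E] [CompleteSpace F] {a : Cardinal.{u}}
    (h : hilbertDim E = hilbertDim F + a) :
    ∃ C : E →L[ℂ] F, Function.Surjective C ∧ hilbertDim ↥(C : E →ₗ[ℂ] F).ker = a := by
  obtain ⟨X, _, _, _, rfl⟩ := exists_hilbertDim_eq a
  rw [← hilbertDim_prod] at h
  obtain ⟨e⟩ := exists_linearIsometryEquiv h
  -- `E` is isometric to `F ⊕ X` with `dim X = a`, and `C` is the projection to the first summand.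
  let C : E →L[ℂ] F :=
    WithLp.fstL 2 ℂ F X ∘L (e.toContinuousLinearEquiv : E →L[ℂ] WithLp 2 (F × X))
  have hC : ∀ x, C x = (e x).fst := fun x => rfl
  refine ⟨C, fun y => ⟨e.symm (WithLp.toLp 2 (y, 0)), by simp [hC]⟩, ?_⟩
  have hcl : IsClosed ((C : E →ₗ[ℂ] F).ker : Set E) := C.isClosed_ker
  have : CompleteSpace (C : E →ₗ[ℂ] F).ker := hcl.completeSpace_coe
  refine hilbertDim_eq_of_bijective (WithLp.sndL 2 ℂ F X ∘L
    (e.toContinuousLinearEquiv : E →L[ℂ] WithLp 2 (F × X)) ∘L Submodule.subtypeL _) ⟨?_, ?_⟩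
  · rw [injective_iff_map_eq_zero]
    rintro ⟨x, hx⟩ hx'
    have h1 : (e x).fst = 0 := hx
    have h2 : (e x).snd = 0 := hx'
    have h3 : e x = 0 := WithLp.ofLp_injective 2 (Prod.ext h1 h2)
    ext
    simpa using h3
  · intro y
    refine ⟨⟨e.symm (WithLp.toLp 2 (0, y)), ?_⟩, ?_⟩
    · change C _ = 0
      simp [hC]
    · simp

theorem aleph0_le_hilbertDim [CompleteSpace E] (h : ¬ FiniteDimensional ℂ E) :
    ℵ₀ ≤ hilbertDim E := by
  obtain ⟨ι, ⟨b⟩⟩ := exists_hilbertBasis_type E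
  rw [hilbertDim_eq b, ← infinite_iff]
  by_contra hι
  rw [not_infinite_iff_finite] at hι
  have : Fintype ι := Fintype.ofFinite ι
  exact h b.toOrthonormalBasis.toBasis.finiteDimensional_of_finite

end Dimension

/-! ### Spectral subspaces from positive and negative parts. -/

section Spectral

variable {H : Type u} [NormedAddCommGroup H] [InnerProductSpace ℂ H] [CompleteSpace H]

/-- A self-adjoint operator is nonpositive on some closed subspace and nonnegative on its
orthogonal complement, and the subspace is invariant under the commutant of the operator. -/
theorem exists_spectral_subspace (T : H →L[ℂ] H) (hT : IsSelfAdjoint T) :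
    ∃ V : Submodule ℂ H, IsClosed (V : Set H) ∧
      (∀ B : H →L[ℂ] H, Commute T B → ∀ v ∈ V, B v ∈ V) ∧
      (∀ v ∈ V, (inner ℂ (T v) v).re ≤ 0) ∧ ∀ v ∈ Vᗮ, 0 ≤ (inner ℂ (T v) v).re := by
  have hsub : T⁺ - T⁻ = T := CFC.posPart_sub_negPart T hT
  have hmul : T⁺ * T⁻ = 0 := CFC.posPart_mul_negPart T
  have hP : (T⁺).IsPositive :=
    (ContinuousLinearMap.nonneg_iff_isPositive _).1 (CFC.posPart_nonneg T)
  have hN : (T⁻).IsPositive :=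
    (ContinuousLinearMap.nonneg_iff_isPositive _).1 (CFC.negPart_nonneg T)
  have happ : ∀ v, T v = T⁺ v - T⁻ v := fun v => by
    conv_lhs => rw [← hsub]
    rfl
  -- On the kernel of `T⁺` the operator is `-T⁻`. Since `T⁺ T⁻ = 0`, the range of `T⁻` lies in that
  -- kernel, so `T⁻` vanishes on its orthogonal complement.
  refine ⟨((T⁺ : H →L[ℂ] H) : H →ₗ[ℂ] H).ker, (T⁺).isClosed_ker, ?_, ?_, ?_⟩
  · intro B hB v hv
    have hc : Commute (T⁺) B := by
      rw [CFC.posPart_def]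
      exact hB.cfcₙ_real _
    have hv : T⁺ v = 0 := hv
    have : T⁺ (B v) = B (T⁺ v) := congrArg (fun C : H →L[ℂ] H => C v) hc.eq
    change T⁺ (B v) = 0
    rw [this, hv, map_zero]
  · intro v hv
    have hv : T⁺ v = 0 := hv
    rw [happ, hv, zero_sub, inner_neg_left, Complex.neg_re, neg_nonpos]
    exact hN.re_inner_nonneg_left v
  · intro v hv
    have h0 : T⁻ v = 0 := by
      have hmem : T⁻ (T⁻ v) ∈ ((T⁺ : H →L[ℂ] H) : H →ₗ[ℂ] H).ker := by
        change (T⁺ * T⁻) (T⁻ v) = 0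
        rw [hmul]
        rfl
      have := (Submodule.mem_orthogonal' _ _).1 hv _ hmem
      rw [← hN.isSymmetric.apply_clm] at this
      exact inner_self_eq_zero.1 this
    rw [happ, h0, sub_zero]
    exact hP.re_inner_nonneg_left v

/-- For every `ε > 0` there is a closed subspace on which `A` is bounded below by `ε`, on whose
orthogonal complement `A` is bounded by `ε`. -/
theorem exists_bounded_below_subspace (A : H →L[ℂ] H) {ε : ℝ} (hε : 0 < ε) :
    ∃ V : Submodule ℂ H, IsClosed (V : Set H) ∧ (∀ v ∈ V, ε * ‖v‖ ≤ ‖A v‖) ∧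
      ∀ v ∈ Vᗮ, ‖A v‖ ≤ ε * ‖v‖ := by
  set S : H →L[ℂ] H := ContinuousLinearMap.adjoint A * A with hS
  have hSsa : IsSelfAdjoint S := IsSelfAdjoint.star_mul_self A
  -- The quadratic form of `A*A - ε²` is `‖A v‖² - ε² ‖v‖²`, so its sign compares `‖A v‖` with `ε
  -- ‖v‖`.
  have hTsa : IsSelfAdjoint (S - ((ε ^ 2 : ℝ) : ℂ) • (1 : H →L[ℂ] H)) := by
    refine hSsa.sub (IsSelfAdjoint.smul ?_ (.one _))
    exact Complex.conj_ofReal _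
  obtain ⟨W, hW, -, hneg, hpos⟩ := exists_spectral_subspace _ hTsa
  have hin : ∀ v, (inner ℂ ((S - ((ε ^ 2 : ℝ) : ℂ) • (1 : H →L[ℂ] H)) v) v).re
      = ‖A v‖ ^ 2 - (ε * ‖v‖) ^ 2 := by
    intro v
    have h1 : inner ℂ (S v) v = ((‖A v‖ ^ 2 : ℝ) : ℂ) := by
      rw [hS]
      change inner ℂ (ContinuousLinearMap.adjoint A (A v)) v = _
      rw [ContinuousLinearMap.adjoint_inner_left, inner_self_eq_norm_sq_to_K]
      simp
    change (inner ℂ (S v - ((ε ^ 2 : ℝ) : ℂ) • v) v).re = _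
    rw [inner_sub_left, h1, inner_smul_left, inner_self_eq_norm_sq_to_K, Complex.conj_ofReal]
    simp only [Complex.coe_algebraMap, ← Complex.ofReal_pow, ← Complex.ofReal_mul,
      ← Complex.ofReal_sub, Complex.ofReal_re]
    ring
  have : CompleteSpace W := hW.completeSpace_coe
  refine ⟨Wᗮ, W.isClosed_orthogonal, ?_, ?_⟩
  · intro v hv
    have := hpos v hv
    rw [hin] at this
    exact le_of_sq_le_sq (by linarith) (norm_nonneg _)
  · intro v hv
    rw [Submodule.orthogonal_orthogonal] at hv
    have := hneg v hv
    rw [hin] at this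
    exact le_of_sq_le_sq (by linarith) (by positivity)

end Spectral

/-! ### Path connectedness of the invertible group. -/

section GeneralLinear

variable {H : Type u} [NormedAddCommGroup H] [InnerProductSpace ℂ H] [CompleteSpace H]

/-- This is the Lax–Milgram theorem. -/
theorem isUnit_of_re_inner_ge {T : H →L[ℂ] H} {c : ℝ} (hc : 0 < c)
    (h : ∀ x, c * ‖x‖ ^ 2 ≤ (inner ℂ (T x) x).re) : IsUnit T := by
  refine ContinuousLinearMap.isUnit_of_forall_le_norm_inner_map T (c := ⟨c, hc.le⟩) hc fun x => ?_
  rw [mul_comm]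
  exact (h x).trans (Complex.re_le_norm _)

/-- On the segment from `1` to `T`, every point but `T` itself is coercive, hence invertible. -/
theorem joinedIn_one_of_re_inner_nonneg {T : H →L[ℂ] H} (hT : IsUnit T)
    (h : ∀ x, 0 ≤ (inner ℂ (T x) x).re) : JoinedIn {G : H →L[ℂ] H | IsUnit G} 1 T := by
  refine JoinedIn.of_segment_subset ?_
  rintro _ ⟨a, b, ha, hb, hab, rfl⟩
  rcases ha.eq_or_lt with rfl | ha
  · obtain rfl : b = 1 := by linarith
    simpa using hT
  · refine isUnit_of_re_inner_ge ha fun x => ?_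
    have : inner ℂ ((a • (1 : H →L[ℂ] H) + b • T) x) x
        = (a : ℂ) * inner ℂ x x + (b : ℂ) * inner ℂ (T x) x := by
      change inner ℂ (a • x + b • T x) x = _
      rw [inner_add_left, inner_smul_left_eq_smul, inner_smul_left_eq_smul]
      rfl
    rw [this, inner_self_eq_norm_sq_to_K]
    simp only [Complex.coe_algebraMap, ← Complex.ofReal_pow, Complex.add_re, Complex.re_ofReal_mul,
      Complex.ofReal_re]
    have := mul_nonneg hb (h x)
    linarith

theorem JoinedIn.isUnit_mul {S T : H →L[ℂ] H} (hS : JoinedIn {G : H →L[ℂ] H | IsUnit G} 1 S)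
    (hT : JoinedIn {G : H →L[ℂ] H | IsUnit G} 1 T) :
    JoinedIn {G : H →L[ℂ] H | IsUnit G} 1 (S * T) := by
  have h1 : JoinedIn {G : H →L[ℂ] H | IsUnit G} (S * 1) (S * T) := by
    have hm : IsUnit S := hS.target_mem
    have := hT.map_continuousOn (f := fun G => S * G) (by fun_prop)
    refine this.mono ?_
    rintro _ ⟨G, hG, rfl⟩
    exact hm.mul hG
  rw [mul_one] at h1
  exact hS.trans h1

/-- Write `S = (-i)(iS)`: the forms of `iS` and of `-i` have vanishing real part, so both factors
are joined to `1` by segments. -/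
theorem joinedIn_one_of_isSelfAdjoint {S : H →L[ℂ] H} (hS : IsUnit S) (h : IsSelfAdjoint S) :
    JoinedIn {G : H →L[ℂ] H | IsUnit G} 1 S := by
  have hI : ∀ z : ℂ, z ≠ 0 → IsUnit (z • (1 : H →L[ℂ] H)) := fun z hz =>
    (isUnit_one (M := H →L[ℂ] H)).smul (Units.mk0 z hz)
  have h1 : JoinedIn {G : H →L[ℂ] H | IsUnit G} 1 (Complex.I • S) := by
    refine joinedIn_one_of_re_inner_nonneg ?_ fun x => ?_
    · have := (hI Complex.I Complex.I_ne_zero).mul hS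
      rwa [smul_mul_assoc, one_mul] at this
    · have him : (inner ℂ (S x) x).im = 0 := h.isSymmetric.im_inner_apply_self x
      change 0 ≤ (inner ℂ (Complex.I • S x) x).re
      rw [inner_smul_left]
      simp [him]
  have h2 : JoinedIn {G : H →L[ℂ] H | IsUnit G} 1 ((-Complex.I) • (1 : H →L[ℂ] H)) := by
    refine joinedIn_one_of_re_inner_nonneg (hI _ (neg_ne_zero.2 Complex.I_ne_zero)) fun x => ?_
    change 0 ≤ (inner ℂ ((-Complex.I) • x) x).re
    rw [inner_smul_left, inner_self_eq_norm_sq_to_K]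
    simp [← Complex.ofReal_pow]
  have := JoinedIn.isUnit_mul h2 h1
  rwa [smul_mul_smul_comm, one_mul, neg_mul, Complex.I_mul_I, neg_neg, one_smul] at this

open ContinuousLinearMap in
-- Let `V` be a subspace reducing `U`, with `Re U ≤ 0` on `V` and `Re U ≥ 0` on its complement. The
-- reflection `S` that negates `V` makes `Re (S U) ≥ 0`, and `U = S (S U)`.
theorem joinedIn_one_of_star_mul_self {U : H →L[ℂ] H} (hU : IsUnit U) (h : star U * U = 1) :
    JoinedIn {G : H →L[ℂ] H | IsUnit G} 1 U := by
  have h' : U * star U = 1 := by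
    obtain ⟨V, rfl⟩ := hU
    rw [← Units.inv_eq_of_mul_eq_one_left h, V.mul_inv]
  obtain ⟨V, hV, hinv, hneg, hpos⟩ :=
    exists_spectral_subspace (U + star U) (IsSelfAdjoint.add_star_self U)
  have : CompleteSpace V := hV.completeSpace_coe
  have hcU : Commute (U + star U) U := by
    change (U + star U) * U = U * (U + star U)
    rw [add_mul, mul_add, h, h']
  have hcU' : Commute (U + star U) (star U) := by
    change (U + star U) * star U = star U * (U + star U)
    rw [add_mul, mul_add, h, h']
  have hre : ∀ v, (inner ℂ ((U + star U) v) v).re = 2 * (inner ℂ (U v) v).re := by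
    intro v
    have : inner ℂ ((U + star U) v) v = inner ℂ (U v) v + inner ℂ v (U v) := by
      rw [← adjoint_inner_left U, ← inner_add_left]
      rfl
    rw [this, ← inner_conj_symm v (U v), Complex.add_re, Complex.conj_re, two_mul]
  let S : H →L[ℂ] H := 1 - (2 : ℂ) • V.starProjection
  have hP : IsSelfAdjoint V.starProjection := isSelfAdjoint_starProjection V
  have hPP : V.starProjection * V.starProjection = V.starProjection :=
    V.isIdempotentElem_starProjection
  have hS : IsSelfAdjoint S := (IsSelfAdjoint.one _).sub (IsSelfAdjoint.smul (by simp) hP)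
  have hSS : S * S = 1 := by
    simp only [S]
    rw [sub_mul, mul_sub, mul_sub, smul_mul_smul_comm, hPP, one_mul, one_mul, mul_one]
    module
  have hSu : IsUnit S := ⟨⟨S, S, hSS, hSS⟩, rfl⟩
  have hj : JoinedIn {G : H →L[ℂ] H | IsUnit G} 1 (S * U) := by
    refine joinedIn_one_of_re_inner_nonneg (hSu.mul hU) fun x => ?_
    obtain ⟨v, hv, w, hw, rfl⟩ : ∃ v ∈ V, ∃ w ∈ Vᗮ, v + w = x :=
      Submodule.mem_sup.1 (by rw [Submodule.sup_orthogonal_of_hasOrthogonalProjection]; trivial)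
    have hUv : U v ∈ V := hinv _ hcU v hv
    have hUw : U w ∈ Vᗮ := by
      rw [Submodule.mem_orthogonal]
      intro y hy
      rw [← adjoint_inner_left]
      exact (Submodule.mem_orthogonal _ _).1 hw _ (hinv _ hcU' y hy)
    have hSx : (S * U) (v + w) = U w - U v := by
      change S (U (v + w)) = _
      have h1 : V.starProjection (U v) = U v := Submodule.starProjection_eq_self_iff.2 hUv
      have h2 : V.starProjection (U w) = 0 :=
        (Submodule.starProjection_apply_eq_zero_iff V).2 hUw
      change U (v + w) - (2 : ℂ) • V.starProjection (U (v + w)) = _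
      rw [map_add, map_add, h1, h2]
      module
    rw [hSx, inner_sub_left, inner_add_right, inner_add_right,
      (Submodule.mem_orthogonal' _ _).1 hUw v hv, (Submodule.mem_orthogonal _ _).1 hw _ hUv]
    have h1 := hneg v hv
    have h2 := hpos w hw
    rw [hre] at h1 h2
    simp only [zero_add, add_zero, Complex.sub_re]
    linarith
  have := JoinedIn.isUnit_mul (joinedIn_one_of_isSelfAdjoint hSu hS) hj
  rwa [← mul_assoc, hSS, one_mul] at this

/-- The group of invertible operators on a Hilbert space is path connected. -/
theorem joinedIn_one_of_isUnit {G : H →L[ℂ] H} (hG : IsUnit G) :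
    JoinedIn {G : H →L[ℂ] H | IsUnit G} 1 G := by
  have hnn : 0 ≤ star G * G := star_mul_self_nonneg G
  -- Polar decomposition: `G = (G R⁻¹) R` with `R` self-adjoint and `G R⁻¹` unitary.
  set R := CFC.sqrt (star G * G) with hR
  have hRR : R * R = star G * G := CFC.sqrt_mul_sqrt_self _ hnn
  have hR0 : 0 ≤ R := CFC.sqrt_nonneg _
  have hRsa : IsSelfAdjoint R := .of_nonneg hR0
  have hRu : IsUnit R := by
    have : IsUnit (R * R) := hRR ▸ hG.star.mul hG
    exact ((Commute.refl R).isUnit_mul_iff.1 this).1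
  have hRj : JoinedIn {G : H →L[ℂ] H | IsUnit G} 1 R := joinedIn_one_of_isSelfAdjoint hRu hRsa
  obtain ⟨r, hr⟩ := hRu
  have hU : JoinedIn {G : H →L[ℂ] H | IsUnit G} 1 (G * ↑r⁻¹) := by
    refine joinedIn_one_of_star_mul_self (hG.mul r⁻¹.isUnit) ?_
    have hrs : star (↑r⁻¹ : H →L[ℂ] H) = ↑r⁻¹ := by
      have : star r = r := Units.ext (by rw [Units.coe_star, hr]; exact hRsa)
      rw [← Units.coe_star, star_inv, this]
    rw [star_mul, hrs, mul_assoc, ← mul_assoc (star G), ← hRR, ← hr, mul_assoc, Units.mul_inv,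
      mul_one, Units.inv_mul]
  have := JoinedIn.isUnit_mul hU hRj
  rwa [mul_assoc, ← hr, Units.inv_mul, mul_one] at this

end GeneralLinear

/-! ### Differences of cardinals. -/

section Arithmetic

variable {a b c d m n κ : Cardinal.{u}}

theorem difference_of_lt (ha : ℵ₀ ≤ a) (h : b < a) :
    difference a b = SignedCardinal.ofCardinal a := by
  rw [difference, if_neg fun h' => h'.1.not_ge ha, if_pos h]

theorem difference_of_gt (hb : ℵ₀ ≤ b) (h : a < b) :
    difference a b = -SignedCardinal.ofCardinal b := by
  rw [difference, if_neg fun h' => h'.2.not_ge hb, if_neg h.not_gt]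

theorem difference_natCast (m n : ℕ) :
    difference (m : Cardinal.{u}) n = SignedCardinal.ofInt ((m : ℤ) - n) := by
  rw [difference, if_pos ⟨natCast_lt_aleph0, natCast_lt_aleph0⟩, toNat_natCast, toNat_natCast]

/-- The cases in which a difference of cardinals is defined. -/
theorem DifferenceDefined.cases (h : DifferenceDefined a b) :
    (a < ℵ₀ ∧ b < ℵ₀) ∨ (ℵ₀ ≤ a ∧ b < a) ∨ (ℵ₀ ≤ b ∧ a < b) := by
  rcases lt_or_ge a ℵ₀ with ha | ha
  · rcases lt_or_ge b ℵ₀ with hb | hb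
    · exact Or.inl ⟨ha, hb⟩
    · exact Or.inr (Or.inr ⟨hb, ha.trans_le hb⟩)
  · rcases lt_trichotomy a b with hab | rfl | hab
    · exact Or.inr (Or.inr ⟨ha.trans hab.le, hab⟩)
    · rcases h with h | h
      · exact absurd h.2 ha.not_gt
      · exact absurd rfl h
    · exact Or.inr (Or.inl ⟨ha, hab⟩)

theorem differenceDefined_of_lt_aleph0 (ha : a < ℵ₀) : DifferenceDefined a b := by
  by_cases h : a = b
  · exact Or.inl ⟨h, h ▸ ha⟩
  · exact Or.inr h

theorem not_differenceDefined_iff : ¬ DifferenceDefined a b ↔ a = b ∧ ℵ₀ ≤ b := by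
  constructor
  · intro h
    have hab : a = b := by
      by_contra hab
      exact h (Or.inr hab)
    exact ⟨hab, not_lt.1 fun hb => h (Or.inl ⟨hab, hb⟩)⟩
  · rintro ⟨rfl, hb⟩ (h | h)
    · exact h.2.not_ge hb
    · exact h rfl

/-- Lowering a common summand changes neither a defined difference nor its being defined. -/
theorem DifferenceDefined.add_right_mono (h : DifferenceDefined (n + c) (m + c)) (hd : d ≤ c) :
    DifferenceDefined (n + d) (m + d) ∧ difference (n + d) (m + d) = difference (n + c) (m + c) := by
  -- If `n + c` is infinite and exceeds `m + c`, it exceeds `c`; so `n` is infinite, absorbs `c` and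
  -- `d`, and equals the sum.
  have key : ∀ {n m : Cardinal.{u}}, ℵ₀ ≤ n + c → m + c < n + c → n + c = n ∧ n + d = n ∧
      m + d < n ∧ ℵ₀ ≤ n := by
    intro n m hinf hlt
    have hc : c < n + c := (self_le_add_left c m).trans_lt hlt
    have hn : ℵ₀ ≤ n := by
      by_contra hn
      rcases lt_or_ge c ℵ₀ with hc' | hc'
      · exact hinf.not_gt (add_lt_aleph0 (not_le.1 hn) hc')
      · rw [add_eq_right hc' ((not_le.1 hn).le.trans hc')] at hc
        exact hc.false
    have hcn : c ≤ n := by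
      by_contra hcn
      rw [add_eq_right (hn.trans (not_le.1 hcn).le) (not_le.1 hcn).le] at hc
      exact hc.false
    have h1 : n + c = n := add_eq_left hn hcn
    have h2 : n + d = n := add_eq_left hn (hd.trans hcn)
    exact ⟨h1, h2, (add_le_add_right hd m).trans_lt (h1 ▸ hlt), hn⟩
  rcases h.cases with ⟨h1, h2⟩ | ⟨h1, h2⟩ | ⟨h1, h2⟩
  · obtain ⟨hn, hc⟩ := add_lt_aleph0_iff.1 h1
    obtain ⟨hm, -⟩ := add_lt_aleph0_iff.1 h2
    have hd' := hd.trans_lt hc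
    refine ⟨differenceDefined_of_lt_aleph0 (add_lt_aleph0 hn hd'), ?_⟩
    obtain ⟨n, rfl⟩ := lt_aleph0.1 hn
    obtain ⟨m, rfl⟩ := lt_aleph0.1 hm
    obtain ⟨c, rfl⟩ := lt_aleph0.1 hc
    obtain ⟨d, rfl⟩ := lt_aleph0.1 hd'
    rw [← Nat.cast_add, ← Nat.cast_add, ← Nat.cast_add, ← Nat.cast_add, difference_natCast,
      difference_natCast]
    congr 1
    push_cast
    ring
  · obtain ⟨e1, e2, e3, e4⟩ := key h1 h2
    rw [difference_of_lt h1 h2, e1, e2, difference_of_lt e4 e3]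
    exact ⟨Or.inr e3.ne', rfl⟩
  · obtain ⟨e1, e2, e3, e4⟩ := key h1 h2
    rw [difference_of_gt h1 h2, e1, e2, difference_of_gt e4 e3]
    exact ⟨Or.inr e3.ne, rfl⟩

theorem DifferenceDefined.symm (h : DifferenceDefined a b) : DifferenceDefined b a := by
  rcases h with ⟨rfl, h⟩ | h
  · exact Or.inl ⟨rfl, h⟩
  · exact Or.inr h.symm

theorem SignedCardinal.ofInt_natCast_sub (m n : ℕ) :
    SignedCardinal.ofInt.{u} ((m : ℤ) - n) = ⟨((m - n : ℕ) : Cardinal), ((n - m : ℕ) : Cardinal), by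
      rcases le_total m n with h | h
      · exact Or.inl (by rw [Nat.sub_eq_zero_of_le h, Nat.cast_zero])
      · exact Or.inr (by rw [Nat.sub_eq_zero_of_le h, Nat.cast_zero])⟩ := by
  unfold SignedCardinal.ofInt
  split_ifs with h
  · have h1 : ((m : ℤ) - n).natAbs = m - n := by omega
    have h2 : n - m = 0 := by omega
    simp [SignedCardinal.ofCardinal, h1, h2]
  · have h1 : ((m : ℤ) - n).natAbs = n - m := by omega
    have h2 : m - n = 0 := by omega
    ext1
    · simp [h2]
      rfl
    · rw [h1]
      rfl

theorem difference_swap (h : DifferenceDefined a b) : difference b a = -difference a b := by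
  rcases h.cases with ⟨h1, h2⟩ | ⟨h1, h2⟩ | ⟨h1, h2⟩
  · obtain ⟨m, rfl⟩ := lt_aleph0.1 h1
    obtain ⟨n, rfl⟩ := lt_aleph0.1 h2
    rw [difference_natCast, difference_natCast, SignedCardinal.ofInt_natCast_sub,
      SignedCardinal.ofInt_natCast_sub]
    rfl
  · rw [difference_of_lt h1 h2, difference_of_gt h1 h2]
  · rw [difference_of_lt h1 h2, difference_of_gt h1 h2]
    rfl

theorem abs_difference_le (h : DifferenceDefined a b) (ha : a ≤ κ) (hb : b ≤ κ) :
    (difference a b).abs ≤ κ := by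
  rcases h.cases with ⟨h1, h2⟩ | ⟨h1, h2⟩ | ⟨h1, h2⟩
  · obtain ⟨m, rfl⟩ := lt_aleph0.1 h1
    obtain ⟨n, rfl⟩ := lt_aleph0.1 h2
    rw [difference_natCast, SignedCardinal.ofInt_natCast_sub, SignedCardinal.abs]
    rw [← Nat.cast_add]
    rcases le_total m n with h | h
    · exact (Nat.cast_le.2 (by omega)).trans hb
    · exact (Nat.cast_le.2 (by omega)).trans ha
  · rw [difference_of_lt h1 h2]
    exact (add_zero a).trans_le ha
  · rw [difference_of_gt h1 h2]
    exact (zero_add b).trans_le hb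

/-- For a nonnegative index this turns a subtraction into the codimension equation that
`exists_surjective_modification` requires. -/
theorem eq_add_posPart_difference (h : DifferenceDefined a b)
    (hneg : (difference a b).negPart = 0) : a = b + (difference a b).posPart := by
  rcases h.cases with ⟨h1, h2⟩ | ⟨h1, h2⟩ | ⟨h1, h2⟩
  · obtain ⟨m, rfl⟩ := lt_aleph0.1 h1
    obtain ⟨n, rfl⟩ := lt_aleph0.1 h2
    rw [difference_natCast, SignedCardinal.ofInt_natCast_sub] at hneg ⊢
    have h0 : ((n - m : ℕ) : Cardinal.{u}) = 0 := hneg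
    rw [Nat.cast_eq_zero] at h0
    change (m : Cardinal) = n + ((m - n : ℕ) : Cardinal)
    rw [← Nat.cast_add]
    congr 1
    omega
  · rw [difference_of_lt h1 h2]
    exact (add_eq_right h1 h2.le).symm
  · rw [difference_of_gt h1 h2] at hneg
    have h0 : b = 0 := hneg
    rw [h0] at h1
    exact absurd h1 aleph0_pos.not_ge

theorem differenceDefined_zero : DifferenceDefined a 0 :=
  (differenceDefined_of_lt_aleph0 aleph0_pos).symm

theorem difference_posPart_zero {γ : SignedCardinal.{u}} (h : γ.negPart = 0) :
    difference γ.posPart 0 = γ := by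
  obtain ⟨p, q, hpq⟩ := γ
  obtain rfl : q = 0 := h
  change difference p 0 = _
  rcases lt_or_ge p ℵ₀ with hp | hp
  · obtain ⟨m, rfl⟩ := lt_aleph0.1 hp
    have := difference_natCast.{u} m 0
    rw [Nat.cast_zero] at this
    rw [this, SignedCardinal.ofInt_natCast_sub]
    ext1
    · simp
    · simp
  · rw [difference_of_lt hp (aleph0_pos.trans_le hp)]
    rfl

theorem SignedCardinal.abs_eq_posPart {γ : SignedCardinal.{u}} (h : γ.negPart = 0) :
    γ.abs = γ.posPart := by
  rw [SignedCardinal.abs, h, add_zero]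

theorem SignedCardinal.abs_neg (γ : SignedCardinal.{u}) : (-γ).abs = γ.abs :=
  add_comm _ _

end Arithmetic

/-! ### Codimensions of subspaces on which an operator is bounded below. -/

section Codimensions

variable {H K : Type u} [NormedAddCommGroup H] [InnerProductSpace ℂ H]
  [NormedAddCommGroup K] [InnerProductSpace ℂ K]

/-- `A` is bounded below on some closed subspace `V` such that `V` has codimension `a` and its
image has codimension `b`. -/
def HasCodims (A : H →L[ℂ] K) (a b : Cardinal.{u}) : Prop :=
  ∃ V : Submodule ℂ H, IsClosed (V : Set H) ∧ (∃ c : ℝ, 0 < c ∧ ∀ v ∈ V, c * ‖v‖ ≤ ‖A v‖) ∧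
    hilbertDim ↥(Vᗮ) = a ∧ hilbertDim ↥(V.map (A : H →ₗ[ℂ] K))ᗮ = b

variable {A B : H →L[ℂ] K} {V : Submodule ℂ H} {c : ℝ}

theorem isClosed_map_of_le_norm [CompleteSpace H] (hV : IsClosed (V : Set H)) (hc : 0 < c)
    (hA : ∀ v ∈ V, c * ‖v‖ ≤ ‖A v‖) : IsClosed (V.map (A : H →ₗ[ℂ] K) : Set K) := by
  have : CompleteSpace V := hV.completeSpace_coe
  have h : AntilipschitzWith (⟨c, hc.le⟩ : NNReal)⁻¹ (A ∘L V.subtypeL) := by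
    refine ContinuousLinearMap.antilipschitz_of_bound _ fun v => ?_
    change ‖(v : H)‖ ≤ c⁻¹ * ‖A v‖
    rw [inv_mul_eq_div, le_div_iff₀ hc, mul_comm]
    exact hA v v.2
  have := h.isClosed_range (A ∘L V.subtypeL).uniformContinuous
  convert this using 1
  ext y
  simp

theorem eq_zero_of_le_norm (hc : 0 < c) (hA : ∀ v ∈ V, c * ‖v‖ ≤ ‖A v‖) {v : H} (hv : v ∈ V)
    (h : A v = 0) : v = 0 := by
  have := hA v hv
  rw [h, norm_zero] at this
  have h' : ‖v‖ ≤ 0 := by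
    by_contra h'
    exact this.not_gt (mul_pos hc (not_le.1 h'))
  exact norm_le_zero_iff.1 h'

/-- If `x = B v` is orthogonal to `A v`, then `‖B v‖² = ⟨B v, (B - A) v⟩`, so `‖B v‖ ≤ ‖B - A‖ ‖v‖`,
below the lower bound `c ‖v‖` unless `x = 0`. Only `B` need be bounded below, so the roles of `A`
and `B` can be exchanged. -/
theorem eq_zero_of_mem_map_of_mem_orthogonal (hB : ∀ v ∈ V, c * ‖v‖ ≤ ‖B v‖)
    (h : ‖B - A‖ < c) {x : K} (hx : x ∈ V.map (B : H →ₗ[ℂ] K))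
    (hx' : x ∈ (V.map (A : H →ₗ[ℂ] K))ᗮ) : x = 0 := by
  obtain ⟨v, hv, rfl⟩ := hx
  change B v = 0
  have h0 : inner ℂ (B v) (A v) = 0 := (Submodule.mem_orthogonal' _ _).1 hx' _ ⟨v, hv, rfl⟩
  have h1 : ((‖B v‖ ^ 2 : ℝ) : ℂ) = inner ℂ (B v) ((B - A) v) := by
    rw [sub_apply, inner_sub_right, h0, sub_zero, inner_self_eq_norm_sq_to_K]
    simp
  have h2 : ‖B v‖ ^ 2 ≤ ‖B v‖ * (‖B - A‖ * ‖v‖) := by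
    calc ‖B v‖ ^ 2 = ‖((‖B v‖ ^ 2 : ℝ) : ℂ)‖ := by simp
      _ ≤ ‖B v‖ * ‖(B - A) v‖ := by rw [h1]; exact norm_inner_le_norm _ _
      _ ≤ _ := by gcongr; exact ContinuousLinearMap.le_opNorm _ _
  have h3 := hB v hv
  by_contra hne
  have hpos : 0 < ‖B v‖ := norm_pos_iff.2 hne
  have hv0 : 0 < ‖v‖ := norm_pos_iff.2 fun h => hne (by rw [h, map_zero])
  rw [pow_two, mul_le_mul_iff_right₀ hpos] at h2
  exact (h2.trans_lt (mul_lt_mul_of_pos_right h hv0)).not_ge h3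

/-- The codimension of a closed subspace of the range. -/
theorem hilbertDim_orthogonal_of_le_range [CompleteSpace K] {W : Submodule ℂ K}
    (hWR : W ≤ (A : H →ₗ[ℂ] K).range) :
    hilbertDim ↥Wᗮ = hilbertDim ↥(A : H →ₗ[ℂ] K).range.topologicalClosureᗮ +
      hilbertDim ↥((A : H →ₗ[ℂ] K).range.topologicalClosure ⊓ Wᗮ) := by
  set R := (A : H →ₗ[ℂ] K).range.topologicalClosure with hR
  have hRc : IsClosed (R : Set K) := Submodule.isClosed_topologicalClosure _
  have : CompleteSpace R := hRc.completeSpace_coe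
  have hle : Rᗮ ≤ Wᗮ := Submodule.orthogonal_le (hWR.trans (Submodule.le_topologicalClosure _))
  have hdec := Submodule.sup_orthogonal_inf_of_hasOrthogonalProjection hle
  rw [Submodule.orthogonal_orthogonal] at hdec
  refine hilbertDim_eq_add R.isClosed_orthogonal (hRc.inter W.isClosed_orthogonal)
    W.isClosed_orthogonal ?_ hdec
  rw [Submodule.orthogonal_orthogonal]
  exact inf_le_left

variable [CompleteSpace H] [CompleteSpace K]

/-- The codimension of a subspace on which `A` is bounded below. -/
theorem hilbertDim_orthogonal_eq_add (hV : IsClosed (V : Set H)) (hc : 0 < c)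
    (hA : ∀ v ∈ V, c * ‖v‖ ≤ ‖A v‖) :
    hilbertDim ↥Vᗮ = hilbertDim ↥(A : H →ₗ[ℂ] K).ker +
      hilbertDim ↥((A : H →ₗ[ℂ] K).range.topologicalClosure ⊓ (V.map (A : H →ₗ[ℂ] K))ᗮ) := by
  have hW := isClosed_map_of_le_norm hV hc hA
  set W := V.map (A : H →ₗ[ℂ] K) with hWdef
  have hWR : W ≤ (A : H →ₗ[ℂ] K).range := LinearMap.map_le_range
  have : CompleteSpace V := hV.completeSpace_coe
  have : CompleteSpace W := hW.completeSpace_coe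
  set Z := (A : H →ₗ[ℂ] K).range.topologicalClosure ⊓ Wᗮ with hZ
  have hZc : IsClosed (Z : Set K) :=
    (Submodule.isClosed_topologicalClosure _).inter W.isClosed_orthogonal
  have hN : IsClosed ((A : H →ₗ[ℂ] K).ker : Set H) := A.isClosed_ker
  -- Split `Vᗮ` into `K₁`, the vectors that `A` sends into `W = A(V)`, and its complement there.
  -- Correcting by vectors of `V` matches `K₁` with the kernel of `A`.
  set K₁ : Submodule ℂ H := Vᗮ ⊓ W.comap (A : H →ₗ[ℂ] K) with hK₁
  have hK₁c : IsClosed (K₁ : Set H) := V.isClosed_orthogonal.inter (hW.preimage A.continuous)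
  have : CompleteSpace K₁ := hK₁c.completeSpace_coe
  have hK₂c : IsClosed ((K₁ᗮ ⊓ Vᗮ : Submodule ℂ H) : Set H) :=
    K₁.isClosed_orthogonal.inter V.isClosed_orthogonal
  have hdec := Submodule.sup_orthogonal_inf_of_hasOrthogonalProjection
    (inf_le_left : K₁ ≤ Vᗮ)
  rw [hilbertDim_eq_add hK₁c hK₂c V.isClosed_orthogonal inf_le_left hdec]
  have hsplit : ∀ x : H, ∃ v ∈ V, ∃ w ∈ Vᗮ, v + w = x := fun x =>
    Submodule.mem_sup.1 (by rw [Submodule.sup_orthogonal_of_hasOrthogonalProjection]; trivial)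
  congr 1
  · refine le_antisymm (hilbertDim_le_of_inf_orthogonal_eq_bot hK₁c hN fun y hy hy' => ?_)
      (hilbertDim_le_of_inf_orthogonal_eq_bot hN hK₁c fun x hx hx' => ?_)
    · obtain ⟨v, hv, hvy⟩ : A y ∈ W := hy.2
      have hker : y - v ∈ (A : H →ₗ[ℂ] K).ker := by
        rw [LinearMap.mem_ker, map_sub, hvy]
        exact sub_self _
      have h0 := (Submodule.mem_orthogonal' _ _).1 hy' _ hker
      rw [inner_sub_right, (Submodule.mem_orthogonal' _ _).1 hy.1 v hv, sub_zero] at h0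
      exact inner_self_eq_zero.1 h0
    · obtain ⟨v, hv, y, hy, rfl⟩ := hsplit x
      have hx : A (v + y) = 0 := hx
      rw [map_add] at hx
      have hyK : y ∈ K₁ := by
        refine ⟨hy, -v, V.neg_mem hv, ?_⟩
        change A (-v) = A y
        rw [map_neg, neg_eq_of_add_eq_zero_right hx]
      have h0 := (Submodule.mem_orthogonal' _ _).1 hx' y hyK
      rw [inner_add_left, (Submodule.mem_orthogonal _ _).1 hy v hv, zero_add,
        inner_self_eq_zero] at h0
      subst h0
      rw [map_zero, add_zero] at hx
      rw [add_zero]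
      exact eq_zero_of_le_norm hc hA hv hx
  · have : CompleteSpace ↥(K₁ᗮ ⊓ Vᗮ) := hK₂c.completeSpace_coe
    have : CompleteSpace Z := hZc.completeSpace_coe
    have hproj : ∀ x : H, A x - W.starProjection (A x) ∈ Z := fun x =>
      ⟨Submodule.le_topologicalClosure _ ((A : H →ₗ[ℂ] K).range.sub_mem ⟨x, rfl⟩
        (hWR (W.starProjection_apply_mem _))), W.sub_starProjection_mem_orthogonal _⟩
    -- The part of `A` orthogonal to `W` is injective on the complement of `K₁` and has dense range
    -- in `Z`, so the dimensions agree.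
    let T : ↥(K₁ᗮ ⊓ Vᗮ) →L[ℂ] Z :=
      ((A - W.starProjection ∘L A) ∘L Submodule.subtypeL _).codRestrict Z fun x => hproj x
    have hT : ∀ y, (T y : K) = A y - W.starProjection (A y) := fun y => rfl
    refine le_antisymm (hilbertDim_le_of_injective T fun y hy => ?_)
      (hilbertDim_le_of_forall_inner_eq_zero T fun z hz => ?_)
    · have h0 : (T y : K) = 0 := congrArg Subtype.val hy
      rw [hT, sub_eq_zero] at h0
      have hyK : (y : H) ∈ K₁ := ⟨y.2.2, by
        change A y ∈ W
        rw [h0]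
        exact W.starProjection_apply_mem _⟩
      ext
      exact inner_self_eq_zero.1 ((Submodule.mem_orthogonal _ _).1 y.2.1 y hyK)
    · have hzW : ∀ w ∈ W, inner ℂ (z : K) w = 0 := (Submodule.mem_orthogonal' _ _).1 z.2.2
      have hzR : (z : K) ∈ ((A : H →ₗ[ℂ] K).range)ᗮ := by
        rw [Submodule.mem_orthogonal']
        rintro _ ⟨x, rfl⟩
        change inner ℂ (z : K) (A x) = 0
        obtain ⟨v, hv, w, hw, rfl⟩ := hsplit x
        rw [← hdec] at hw
        obtain ⟨k, hk, y, hy, rfl⟩ := Submodule.mem_sup.1 hw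
        have h1 := hzW (A v) ⟨v, hv, rfl⟩
        have h2 := hzW (A k) hk.2
        have h3 : inner ℂ (z : K) (T ⟨y, hy⟩ : K) = 0 := hz ⟨y, hy⟩
        rw [hT, inner_sub_right, hzW _ (W.starProjection_apply_mem _), sub_zero] at h3
        rw [map_add, map_add, inner_add_right, inner_add_right, h1, h2, h3, add_zero, add_zero]
      rw [← Submodule.orthogonal_closure] at hzR
      ext
      exact inner_self_eq_zero.1 ((Submodule.mem_orthogonal _ _).1 hzR z z.2.1)

/-- Codimensions are obtained from the nullity and the corank by adding the same cardinal. -/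
theorem HasCodims.exists_eq_add {a b : Cardinal.{u}} (h : HasCodims A a b) :
    ∃ d, incompletenessIndex (A : H →ₗ[ℂ] K).range ≤ d ∧
      a = hilbertDim ↥(A : H →ₗ[ℂ] K).ker + d ∧
      b = hilbertDim ↥(A : H →ₗ[ℂ] K).range.topologicalClosureᗮ + d := by
  obtain ⟨V, hV, ⟨c, hc, hA⟩, rfl, rfl⟩ := h
  have hW := isClosed_map_of_le_norm hV hc hA
  have hWR : V.map (A : H →ₗ[ℂ] K) ≤ (A : H →ₗ[ℂ] K).range := LinearMap.map_le_range
  exact ⟨_, csInf_le' ⟨_, hWR, hW.isComplete, rfl⟩, hilbertDim_orthogonal_eq_add hV hc hA,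
    hilbertDim_orthogonal_of_le_range hWR⟩

theorem HasCodims.initialIndex_le {a b : Cardinal.{u}} (h : HasCodims A a b) :
    initialIndex A ≤ a := by
  obtain ⟨d, hd, rfl, -⟩ := h.exists_eq_add
  exact add_le_add_right hd _

theorem HasCodims.finalIndex_le {a b : Cardinal.{u}} (h : HasCodims A a b) :
    finalIndex A ≤ b := by
  obtain ⟨d, hd, -, rfl⟩ := h.exists_eq_add
  exact add_le_add_right hd _

/-- The initial and the final index are the least codimensions. -/
theorem hasCodims_indices (A : H →L[ℂ] K) : HasCodims A (initialIndex A) (finalIndex A) := by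
  have hne : {c | ∃ V : Submodule ℂ K, V ≤ (A : H →ₗ[ℂ] K).range ∧ IsComplete (V : Set K) ∧
      hilbertDim ↥((A : H →ₗ[ℂ] K).range.topologicalClosure ⊓ Vᗮ) = c}.Nonempty :=
    -- The zero subspace is a candidate, so the infimum defining `IC` is attained by well-ordering.
    ⟨_, ⊥, bot_le, (isClosed_singleton (x := (0 : K))).isComplete, rfl⟩
  obtain ⟨W, hWR, hW, hdim⟩ := csInf_mem hne
  replace hW : IsClosed (W : Set K) := hW.isClosed
  set V : Submodule ℂ H := (A : H →ₗ[ℂ] K).kerᗮ ⊓ W.comap (A : H →ₗ[ℂ] K) with hVdef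
  have hV : IsClosed (V : Set H) :=
    (Submodule.isClosed_orthogonal _).inter (hW.preimage A.continuous)
  have : CompleteSpace (A : H →ₗ[ℂ] K).ker := A.isClosed_ker.completeSpace_coe
  have : CompleteSpace V := hV.completeSpace_coe
  have : CompleteSpace W := hW.completeSpace_coe
  have hsurj : ∀ w ∈ W, ∃ v ∈ V, A v = w := by
    intro w hw
    obtain ⟨x, rfl⟩ := hWR hw
    obtain ⟨n, hn, v, hv, rfl⟩ : ∃ n ∈ (A : H →ₗ[ℂ] K).ker, ∃ v ∈ (A : H →ₗ[ℂ] K).kerᗮ,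
        n + v = x :=
      Submodule.mem_sup.1 (by rw [Submodule.sup_orthogonal_of_hasOrthogonalProjection]; trivial)
    have hn : A n = 0 := hn
    have he : A (n + v) = A v := by rw [map_add, hn, zero_add]
    refine ⟨v, ⟨hv, ?_⟩, he.symm⟩
    change A v ∈ W
    rw [← he]
    exact hw
  have hmap : V.map (A : H →ₗ[ℂ] K) = W := by
    ext w
    constructor
    · rintro ⟨v, hv, rfl⟩
      exact hv.2
    · exact hsurj w
  let T : V →L[ℂ] W := (A ∘L V.subtypeL).codRestrict W fun v => v.2.2
  have hT : ∀ v, (T v : K) = A v := fun v => rfl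
  -- By the open mapping theorem the bijection from `V` to `W` has a bounded inverse, which yields
  -- the lower bound.
  let e : V ≃L[ℂ] W := ContinuousLinearEquiv.ofBijective T
    (by
      rw [Submodule.eq_bot_iff]
      intro v hv
      have hv : A v = 0 := congrArg Subtype.val (LinearMap.mem_ker.1 hv)
      ext
      exact inner_self_eq_zero.1 ((Submodule.mem_orthogonal _ _).1 v.2.1 v hv))
    (by
      rw [eq_top_iff]
      rintro ⟨w, hw⟩ -
      obtain ⟨v, hv, rfl⟩ := hsurj w hw
      exact ⟨⟨v, hv⟩, rfl⟩)
  have hbelow : ∃ c : ℝ, 0 < c ∧ ∀ v ∈ V, c * ‖v‖ ≤ ‖A v‖ := by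
    set M := ‖(e.symm : W →L[ℂ] V)‖ + 1 with hM
    have hM0 : 0 < M := by positivity
    refine ⟨M⁻¹, inv_pos.2 hM0, fun v hv => ?_⟩
    rw [inv_mul_eq_div, div_le_iff₀ hM0]
    have h1 := (e.symm : W →L[ℂ] V).le_opNorm (e ⟨v, hv⟩)
    have h2 : (e.symm : W →L[ℂ] V) (e ⟨v, hv⟩) = ⟨v, hv⟩ := e.symm_apply_apply _
    rw [h2] at h1
    change ‖v‖ ≤ _ * ‖A v‖ at h1
    rw [hM]
    nlinarith [norm_nonneg (A v)]
  obtain ⟨c, hc, hA⟩ := hbelow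
  refine ⟨V, hV, ⟨c, hc, hA⟩, ?_, ?_⟩
  · rw [hilbertDim_orthogonal_eq_add hV hc hA, hmap, hdim]
    rfl
  · rw [hmap, hilbertDim_orthogonal_of_le_range hWR, hdim]
    rfl

/-- Codimensions are stable under small perturbations. -/
theorem HasCodims.eventually {a b : Cardinal.{u}} (h : HasCodims A a b) :
    ∀ᶠ B in nhds A, HasCodims B a b := by
  obtain ⟨V, hV, ⟨c, hc, hA⟩, rfl, rfl⟩ := h
  filter_upwards [Metric.ball_mem_nhds A (half_pos hc)] with B hB
  rw [mem_ball_iff_norm] at hB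
  have hB' : ∀ v ∈ V, c / 2 * ‖v‖ ≤ ‖B v‖ := by
    intro v hv
    have h1 := hA v hv
    have h2 : ‖A v‖ ≤ ‖B v‖ + ‖(B - A) v‖ := by
      rw [sub_apply]
      calc ‖A v‖ = ‖B v - (B v - A v)‖ := by rw [sub_sub_cancel]
        _ ≤ _ := norm_sub_le _ _
    have h3 := (B - A).le_opNorm v
    have h4 : ‖B - A‖ * ‖v‖ ≤ c / 2 * ‖v‖ := by gcongr
    linarith
  have hAc := isClosed_map_of_le_norm hV hc hA
  have hBc := isClosed_map_of_le_norm hV (half_pos hc) hB'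
  have : CompleteSpace (V.map (A : H →ₗ[ℂ] K)) := hAc.completeSpace_coe
  have : CompleteSpace (V.map (B : H →ₗ[ℂ] K)) := hBc.completeSpace_coe
  refine ⟨V, hV, ⟨c / 2, half_pos hc, hB'⟩, rfl, le_antisymm ?_ ?_⟩
  · refine hilbertDim_le_of_inf_orthogonal_eq_bot (Submodule.isClosed_orthogonal _)
      (Submodule.isClosed_orthogonal _) fun x hx hx' => ?_
    rw [Submodule.orthogonal_orthogonal] at hx'
    rw [norm_sub_rev] at hB
    exact eq_zero_of_mem_map_of_mem_orthogonal hA (by linarith) hx' hx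
  · refine hilbertDim_le_of_inf_orthogonal_eq_bot (Submodule.isClosed_orthogonal _)
      (Submodule.isClosed_orthogonal _) fun x hx hx' => ?_
    rw [Submodule.orthogonal_orthogonal] at hx'
    exact eq_zero_of_mem_map_of_mem_orthogonal hB' hB hx' hx

open ContinuousLinearMap in
/-- The adjoint has the same codimensions in reverse order. -/
theorem HasCodims.adjoint {a b : Cardinal.{u}} (h : HasCodims A a b) :
    HasCodims (adjoint A) b a := by
  obtain ⟨V, hV, ⟨c, hc, hA⟩, rfl, rfl⟩ := h
  have hW := isClosed_map_of_le_norm hV hc hA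
  have hA' : ∀ w ∈ V.map (A : H →ₗ[ℂ] K), c * ‖w‖ ≤ ‖ContinuousLinearMap.adjoint A w‖ := by
    rintro _ ⟨v, hv, rfl⟩
    change c * ‖A v‖ ≤ ‖ContinuousLinearMap.adjoint A (A v)‖
    have h1 := hA v hv
    -- By Cauchy–Schwarz for `⟨A*A v, v⟩ = ‖A v‖²`; this makes the adjoint bounded below on `A(V)`
    -- with the same constant `c`.
    have h2 : ‖A v‖ ^ 2 ≤ ‖ContinuousLinearMap.adjoint A (A v)‖ * ‖v‖ := by
      have : inner ℂ (ContinuousLinearMap.adjoint A (A v)) v = ((‖A v‖ ^ 2 : ℝ) : ℂ) := by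
        rw [adjoint_inner_left, inner_self_eq_norm_sq_to_K]
        simp
      calc ‖A v‖ ^ 2 = ‖((‖A v‖ ^ 2 : ℝ) : ℂ)‖ := by simp
        _ ≤ _ := by rw [← this]; exact norm_inner_le_norm _ _
    rcases (norm_nonneg v).eq_or_lt with hv0 | hv0
    · rw [norm_eq_zero.1 hv0.symm]
      simp
    · have h3 : c * ‖A v‖ * ‖v‖ ≤ ‖ContinuousLinearMap.adjoint A (A v)‖ * ‖v‖ := by
        refine le_trans ?_ h2
        nlinarith [norm_nonneg (A v)]
      exact le_of_mul_le_mul_right h3 hv0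
  have hX := isClosed_map_of_le_norm hW hc hA'
  set W := V.map (A : H →ₗ[ℂ] K) with hWdef
  set X := W.map (ContinuousLinearMap.adjoint A : K →ₗ[ℂ] H) with hXdef
  have : CompleteSpace V := hV.completeSpace_coe
  have : CompleteSpace X := hX.completeSpace_coe
  refine ⟨W, hW, ⟨c, hc, hA'⟩, rfl, le_antisymm ?_ ?_⟩
  · refine hilbertDim_le_of_inf_orthogonal_eq_bot (Submodule.isClosed_orthogonal _)
      (Submodule.isClosed_orthogonal _) fun x hx hx' => ?_
    rw [Submodule.orthogonal_orthogonal] at hx'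
    have h0 : inner ℂ x (ContinuousLinearMap.adjoint A (A x)) = 0 :=
      (Submodule.mem_orthogonal' _ _).1 hx _ ⟨_, ⟨x, hx', rfl⟩, rfl⟩
    rw [adjoint_inner_right, inner_self_eq_zero] at h0
    exact eq_zero_of_le_norm hc hA hx' h0
  · refine hilbertDim_le_of_inf_orthogonal_eq_bot (Submodule.isClosed_orthogonal _)
      (Submodule.isClosed_orthogonal _) fun x hx hx' => ?_
    rw [Submodule.orthogonal_orthogonal] at hx'
    obtain ⟨_, ⟨v, hv, rfl⟩, rfl⟩ := hx'
    have h0 : inner ℂ (ContinuousLinearMap.adjoint A (A v)) v = 0 :=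
      (Submodule.mem_orthogonal' _ _).1 hx _ hv
    rw [adjoint_inner_left, inner_self_eq_zero] at h0
    change ContinuousLinearMap.adjoint A (A v) = 0
    rw [h0, map_zero]

end Codimensions

variable {H : Type u} [NormedAddCommGroup H] [InnerProductSpace ℂ H]

/-! ### Openness, adjoints and surjective modifications. -/

section IndexSets

variable {A : H →L[ℂ] H} {γ : SignedCardinal.{u}}

theorem mem_Uind_iff : A ∈ Uind H ↔ initialIndex A = finalIndex A ∧ ℵ₀ ≤ finalIndex A :=
  not_differenceDefined_iff

theorem range_ker_smul {s : ℝ} (hs : s ≠ 0) (A : H →L[ℂ] H) :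
    ((s • A : H →L[ℂ] H) : H →ₗ[ℂ] H).range = (A : H →ₗ[ℂ] H).range ∧
      ((s • A : H →L[ℂ] H) : H →ₗ[ℂ] H).ker = (A : H →ₗ[ℂ] H).ker := by
  have h : ((s • A : H →L[ℂ] H) : H →ₗ[ℂ] H) = (s : ℂ) • (A : H →ₗ[ℂ] H) := by
    ext x
    exact (Complex.coe_smul _ _).symm
  have hs' : (s : ℂ) ≠ 0 := Complex.ofReal_ne_zero.2 hs
  rw [h]
  exact ⟨LinearMap.range_smul _ _ hs', LinearMap.ker_smul _ _ hs'⟩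

variable [CompleteSpace H]

/-- The codimensions exceed nullity and corank by one `d ≥ IC(R(A))`; lowering `d` to `IC(R(A))`
keeps the difference. Hence any codimensions with a defined difference compute the index. -/
theorem HasCodims.mem_Ind {a b : Cardinal.{u}} (h : HasCodims A a b)
    (hd : DifferenceDefined a b) : A ∈ Ind H (difference a b) := by
  obtain ⟨d, hle, rfl, rfl⟩ := h.exists_eq_add
  exact hd.add_right_mono hle

theorem isOpen_Ind (γ : SignedCardinal.{u}) : IsOpen (Ind H γ) := by
  rw [isOpen_iff_mem_nhds]
  rintro A ⟨hA, rfl⟩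
  filter_upwards [(hasCodims_indices A).eventually] with B hB
  exact hB.mem_Ind hA

theorem initialIndex_adjoint (A : H →L[ℂ] H) :
    initialIndex (ContinuousLinearMap.adjoint A) = finalIndex A := by
  refine le_antisymm (hasCodims_indices A).adjoint.initialIndex_le ?_
  have := (hasCodims_indices (ContinuousLinearMap.adjoint A)).adjoint.finalIndex_le
  rwa [ContinuousLinearMap.adjoint_adjoint] at this

theorem finalIndex_adjoint (A : H →L[ℂ] H) :
    finalIndex (ContinuousLinearMap.adjoint A) = initialIndex A := by
  rw [← initialIndex_adjoint, ContinuousLinearMap.adjoint_adjoint]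

theorem adjoint_mem_Ind_neg (hA : A ∈ Ind H γ) : ContinuousLinearMap.adjoint A ∈ Ind H (-γ) := by
  obtain ⟨h, rfl⟩ := hA
  refine ⟨?_, ?_⟩
  · rw [IndexDefined, initialIndex_adjoint, finalIndex_adjoint]
    exact h.symm
  · rw [index, initialIndex_adjoint, finalIndex_adjoint]
    exact difference_swap h

/-- Transfers statements about `γ ≥ 0` to `γ ≤ 0`. -/
theorem image_adjoint_Ind (γ : SignedCardinal.{u}) :
    ContinuousLinearMap.adjoint '' Ind H (-γ) = Ind H γ := by
  refine Set.Subset.antisymm ?_ fun A hA => ?_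
  · rintro _ ⟨A, hA, rfl⟩
    exact adjoint_mem_Ind_neg hA
  · exact ⟨_, adjoint_mem_Ind_neg hA, ContinuousLinearMap.adjoint_adjoint A⟩

theorem mem_Ind_of_surjective (hγ : γ.negPart = 0) (hA : Function.Surjective A)
    (hker : hilbertDim ↥(A : H →ₗ[ℂ] H).ker = γ.posPart) : A ∈ Ind H γ := by
  have hr : (A : H →ₗ[ℂ] H).range = ⊤ := LinearMap.range_eq_top.2 hA
  have htop : (⊤ : Submodule ℂ H).topologicalClosure = ⊤ :=
    (Submodule.le_topologicalClosure _).antisymm' le_top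
  have hIC : incompletenessIndex (A : H →ₗ[ℂ] H).range = 0 := by
    rw [hr]
    refine le_antisymm (csInf_le' ⟨⊤, le_rfl, isComplete_univ, ?_⟩) zero_le
    rw [Submodule.top_orthogonal_eq_bot, inf_bot_eq, hilbertDim_bot]
  have hi : initialIndex A = γ.posPart := by rw [initialIndex, hIC, add_zero, hker]
  have hf : finalIndex A = 0 := by
    rw [finalIndex, hIC, add_zero, hr, htop, Submodule.top_orthogonal_eq_bot, hilbertDim_bot]
  refine ⟨?_, ?_⟩
  · rw [IndexDefined, hi, hf]
    exact differenceDefined_zero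
  · rw [index, hi, hf, difference_posPart_zero hγ]

/-- If `A` is bounded below on a closed subspace `V` and the codimension of `V` exceeds that of its
image by `a`, then replacing `A` on the orthogonal complement of `V` gives operators of `H` onto
`H` with kernels of dimension `a`. -/
theorem exists_surjective_modification {V : Submodule ℂ H} [V.HasOrthogonalProjection] {c : ℝ}
    {a : Cardinal.{u}} (hV : IsClosed (V : Set H)) (hc : 0 < c) (hA : ∀ v ∈ V, c * ‖v‖ ≤ ‖A v‖)
    (hdim : hilbertDim ↥Vᗮ = hilbertDim ↥(V.map (A : H →ₗ[ℂ] H))ᗮ + a) :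
    ∃ C : H →L[ℂ] H, (∀ v ∈ V, C v = 0) ∧ ∀ s : ℝ, s ≠ 0 →
      Function.Surjective (A ∘L V.starProjection + s • C) ∧
      hilbertDim ↥((A ∘L V.starProjection + s • C : H →L[ℂ] H) : H →ₗ[ℂ] H).ker = a := by
  have hW := isClosed_map_of_le_norm hV hc hA
  set W := V.map (A : H →ₗ[ℂ] H) with hWdef
  have : CompleteSpace W := hW.completeSpace_coe
  obtain ⟨C₀, hC₀, hker⟩ := exists_surjective_hilbertDim_ker hdim
  -- `C` maps `Vᗮ` onto `Wᗮ` with kernel of dimension `a`. The factor `s` is left free so that the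
  -- added term can be made small.
  let C : H →L[ℂ] H := Wᗮ.subtypeL ∘L C₀ ∘L Vᗮ.orthogonalProjectionOnto
  have hCW : ∀ x, C x ∈ Wᗮ := fun x => (C₀ (Vᗮ.orthogonalProjectionOnto x)).2
  have hCV : ∀ v ∈ V, C v = 0 := by
    intro v hv
    have : Vᗮ.orthogonalProjectionOnto v = 0 := by
      rw [Submodule.orthogonalProjectionOnto_eq_zero_iff, Submodule.orthogonal_orthogonal]
      exact hv
    simp [C, this]
  have hCV' : ∀ w : Vᗮ, C w = C₀ w := by
    intro w
    simp [C]
  have happ : ∀ (s : ℝ) (x : H), (A ∘L V.starProjection + s • C : H →L[ℂ] H) x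
      = A (V.starProjection x) + s • C x := fun s x => rfl
  refine ⟨C, hCV, fun s hs => ⟨fun y => ?_, ?_⟩⟩
  · obtain ⟨_, ⟨v, hv, rfl⟩, w, hw, rfl⟩ : ∃ w₁ ∈ W, ∃ w ∈ Wᗮ, w₁ + w = y :=
      Submodule.mem_sup.1 (by rw [Submodule.sup_orthogonal_of_hasOrthogonalProjection]; trivial)
    obtain ⟨x, hx⟩ := hC₀ ⟨w, hw⟩
    refine ⟨v + s⁻¹ • (x : H), ?_⟩
    have hx' : V.starProjection (x : H) = 0 :=
      (Submodule.starProjection_apply_eq_zero_iff V).2 x.2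
    have hsx : (s⁻¹ • (x : H)) = ((s⁻¹ : ℝ) : ℂ) • (x : H) := (Complex.coe_smul _ _).symm
    rw [happ, map_add V.starProjection, map_add C, hCV v hv,
      Submodule.starProjection_eq_self_iff.2 hv, hsx, map_smul, map_smul, hx', smul_zero, add_zero, zero_add, hCV', hx, Complex.coe_smul, smul_smul,
      mul_inv_cancel₀ hs, one_smul]
    rfl
  · rw [← hker]
    have hcl : IsClosed ((C₀ : ↥Vᗮ →ₗ[ℂ] ↥Wᗮ).ker : Set ↥Vᗮ) := C₀.isClosed_ker
    have : CompleteSpace (C₀ : ↥Vᗮ →ₗ[ℂ] ↥Wᗮ).ker := hcl.completeSpace_coe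
    have hcl' := (A ∘L V.starProjection + s • C : H →L[ℂ] H).isClosed_ker
    have : CompleteSpace ((A ∘L V.starProjection + s • C : H →L[ℂ] H) : H →ₗ[ℂ] H).ker :=
      hcl'.completeSpace_coe
    symm
    let T : (C₀ : ↥Vᗮ →ₗ[ℂ] ↥Wᗮ).ker →L[ℂ]
        ((A ∘L V.starProjection + s • C : H →L[ℂ] H) : H →ₗ[ℂ] H).ker :=
      (Vᗮ.subtypeL ∘L Submodule.subtypeL _).codRestrict _ fun x => by
        have h1 : C₀ x = 0 := x.2
        have h2 : V.starProjection ((x : ↥Vᗮ) : H) = 0 :=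
          (Submodule.starProjection_apply_eq_zero_iff V).2 (x : ↥Vᗮ).2
        change (A ∘L V.starProjection + s • C : H →L[ℂ] H) (x : ↥Vᗮ) = 0
        rw [happ, h2, hCV', h1]
        simp
    refine hilbertDim_eq_of_bijective T ⟨fun x y hxy => ?_, ?_⟩
    · have h := congrArg Subtype.val hxy
      exact Subtype.ext (Subtype.ext h)
    · rintro ⟨x, hx⟩
      have hx : (A ∘L V.starProjection + s • C : H →L[ℂ] H) x = 0 := hx
      rw [happ] at hx
      have hAx : A (V.starProjection x) ∈ W := ⟨_, V.starProjection_apply_mem x, rfl⟩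
      -- The two summands lie in `W` and `Wᗮ`, so a vanishing sum forces both to vanish.
      have h0 : inner ℂ (A (V.starProjection x)) (s • C x) = 0 := by
        rw [← Complex.coe_smul, inner_smul_right,
          (Submodule.mem_orthogonal _ _).1 (hCW x) _ hAx, mul_zero]
      have h1 : A (V.starProjection x) = 0 := by
        rw [← inner_self_eq_zero (𝕜 := ℂ)]
        have := congrArg (inner ℂ (A (V.starProjection x))) hx
        rwa [inner_add_right, h0, add_zero, inner_zero_right] at this
      have h2 := eq_zero_of_le_norm hc hA (V.starProjection_apply_mem x) h1
      have hxV : x ∈ Vᗮ := (Submodule.starProjection_apply_eq_zero_iff V).1 h2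
      rw [h1, zero_add, smul_eq_zero_iff_right hs] at hx
      refine ⟨⟨⟨x, hxV⟩, ?_⟩, rfl⟩
      have := hCV' ⟨x, hxV⟩
      rw [hx] at this
      exact Subtype.ext this.symm

end IndexSets

/-! ### Closure, boundary and interior of the closure. -/

section Closure

variable [CompleteSpace H] {A : H →L[ℂ] H} {γ : SignedCardinal.{u}}

theorem mem_closure_Ind_of_negPart_eq_zero (hγ : γ.negPart = 0) (hA : A ∈ Uind H)
    (hle : γ.abs ≤ minIndex A) : A ∈ closure (Ind H γ) := by
  obtain ⟨hif, hinf⟩ := mem_Uind_iff.1 hA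
  rw [minIndex, hif, min_self, SignedCardinal.abs_eq_posPart hγ] at hle
  obtain ⟨V₀, hV₀, ⟨c, hc, hA₀⟩, hd₀, -⟩ := hasCodims_indices A
  rw [Metric.mem_closure_iff]
  intro δ hδ
  -- `ε < c` makes `Vᗮ` meet `V₀` only in `0`, so `V` has least codimension; `ε < δ / 2` leaves room
  -- for two errors, from cutting `A` off to `V` and from adding `s • C`.
  obtain ⟨ε, hε, hεc, hεδ⟩ : ∃ ε : ℝ, 0 < ε ∧ ε < c ∧ ε < δ / 2 :=
    ⟨min c (δ / 2) / 2, by positivity, by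
      have : 0 < min c (δ / 2) := by positivity
      linarith [min_le_left c (δ / 2)], by
      have : 0 < min c (δ / 2) := by positivity
      linarith [min_le_right c (δ / 2)]⟩
  obtain ⟨V, hV, hA₁, hA₂⟩ := exists_bounded_below_subspace A hε
  have : CompleteSpace V := hV.completeSpace_coe
  have : CompleteSpace V₀ := hV₀.completeSpace_coe
  have hcod : HasCodims A _ _ := ⟨V, hV, ⟨ε, hε, hA₁⟩, rfl, rfl⟩
  have hdV : hilbertDim ↥Vᗮ = finalIndex A := by
    refine le_antisymm ?_ (hif ▸ hcod.initialIndex_le)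
    rw [← hif, ← hd₀]
    refine hilbertDim_le_of_inf_orthogonal_eq_bot V.isClosed_orthogonal V₀.isClosed_orthogonal
      fun x hx hx' => ?_
    rw [Submodule.orthogonal_orthogonal] at hx'
    have h1 := hA₀ x hx'
    have h2 := hA₂ x hx
    by_contra hne
    have := mul_lt_mul_of_pos_right hεc (norm_pos_iff.2 hne)
    linarith
  have hdW : hilbertDim ↥(V.map (A : H →ₗ[ℂ] H))ᗮ = finalIndex A := by
    refine le_antisymm ?_ hcod.finalIndex_le
    obtain ⟨d, -, h1, h2⟩ := hcod.exists_eq_add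
    rw [h2]
    have hd : d ≤ finalIndex A := by
      rw [← hdV, h1]
      exact self_le_add_left _ _
    have hm : hilbertDim ↥(A : H →ₗ[ℂ] H).range.topologicalClosureᗮ ≤ finalIndex A :=
      self_le_add_right _ _
    exact (add_le_add hm hd).trans (add_eq_self hinf).le
  -- Both codimensions equal the same infinite cardinal, which absorbs `γ`.
  have hdim : hilbertDim ↥Vᗮ = hilbertDim ↥(V.map (A : H →ₗ[ℂ] H))ᗮ + γ.posPart := by
    rw [hdV, hdW, add_eq_left hinf hle]
  obtain ⟨C, -, hC⟩ := exists_surjective_modification hV hε hA₁ hdim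
  obtain ⟨s, hs, hsC⟩ : ∃ s : ℝ, 0 < s ∧ s * ‖C‖ ≤ ε := by
    refine ⟨ε / (‖C‖ + 1), by positivity, ?_⟩
    rw [div_mul_eq_mul_div, div_le_iff₀ (by positivity)]
    nlinarith [norm_nonneg C]
  obtain ⟨hsurj, hker⟩ := hC s hs.ne'
  refine ⟨_, mem_Ind_of_surjective hγ hsurj hker, ?_⟩
  rw [dist_eq_norm]
  have h1 : ‖A - A ∘L V.starProjection‖ ≤ ε := by
    refine ContinuousLinearMap.opNorm_le_bound _ hε.le fun x => ?_
    have hx : x - V.starProjection x ∈ Vᗮ := V.sub_starProjection_mem_orthogonal x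
    have he : (A - A ∘L V.starProjection) x = A (x - V.starProjection x) := by
      rw [map_sub]
      rfl
    rw [he]
    refine (hA₂ _ hx).trans ?_
    gcongr
    have := Vᗮ.norm_starProjection_apply_le x
    rwa [Submodule.starProjection_orthogonal_val] at this
  have h2 : ‖s • C‖ ≤ ε := by rwa [norm_smul, Real.norm_of_nonneg hs.le]
  calc ‖A - (A ∘L V.starProjection + s • C)‖ = ‖(A - A ∘L V.starProjection) - s • C‖ := by
        rw [sub_sub]
    _ ≤ ε + ε := (norm_sub_le _ _).trans (add_le_add h1 h2)
    _ < δ := by linarith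

theorem mem_closure_Ind (hA : A ∈ Uind H) (hle : γ.abs ≤ minIndex A) : A ∈ closure (Ind H γ) := by
  rcases γ.eq_zero_or with hγ | hγ
  · obtain ⟨hif, hinf⟩ := mem_Uind_iff.1 hA
    have h1 : ContinuousLinearMap.adjoint A ∈ closure (Ind H (-γ)) := by
      refine mem_closure_Ind_of_negPart_eq_zero hγ ?_ ?_
      · rw [mem_Uind_iff, initialIndex_adjoint, finalIndex_adjoint]
        exact ⟨hif.symm, hif ▸ hinf⟩
      · rwa [minIndex, initialIndex_adjoint, finalIndex_adjoint, SignedCardinal.abs_neg, min_comm]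
    have h2 := image_closure_subset_closure_image
      (ContinuousLinearMap.adjoint (𝕜 := ℂ) (E := H) (F := H)).continuous
      (Set.mem_image_of_mem _ h1)
    rwa [image_adjoint_Ind, ContinuousLinearMap.adjoint_adjoint] at h2
  · exact mem_closure_Ind_of_negPart_eq_zero hγ hA hle

/-- If the index of `A` is defined, its open index set meets `Ind H γ` and so coincides with it.
Otherwise operators near `A` inherit the codimensions `ι_m(A)`, which bound their indices and thus
`|γ|`. -/
theorem closure_Ind_subset (hA : A ∈ closure (Ind H γ)) :
    A ∈ Ind H γ ∨ (A ∈ Uind H ∧ γ.abs ≤ minIndex A) := by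
  by_cases hd : IndexDefined A
  · left
    obtain ⟨B, hB, hB'⟩ := mem_closure_iff.1 hA _ (isOpen_Ind (index A)) ⟨hd, rfl⟩
    exact ⟨hd, hB.2.symm.trans hB'.2⟩
  · right
    refine ⟨hd, ?_⟩
    obtain ⟨B, hB, hB'⟩ := (mem_closure_iff_frequently.1 hA).and_eventually
      (hasCodims_indices A).eventually |>.exists
    obtain ⟨hif, -⟩ := mem_Uind_iff.1 hd
    rw [minIndex, ← hB.2]
    rw [hif] at hB' ⊢
    rw [min_self]
    exact abs_difference_le hB.1 hB'.initialIndex_le hB'.finalIndex_le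

theorem frontier_Ind (γ : SignedCardinal.{u}) :
    frontier (Ind H γ) = {A : H →L[ℂ] H | A ∈ Uind H ∧ γ.abs ≤ minIndex A} := by
  ext A
  rw [frontier, (isOpen_Ind γ).interior_eq]
  constructor
  · rintro ⟨h1, h2⟩
    exact (closure_Ind_subset h1).resolve_left h2
  · rintro ⟨h1, h2⟩
    exact ⟨mem_closure_Ind h1 h2, fun h => h1 h.1⟩

/-- An operator of undefined index lies in the closure of `Ind_n` for every finite `n`. Were it
interior to the closure of `Ind_γ`, the open sets `Ind_n` and `Ind_γ` would meet for some `n ≠ γ`.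
-/
theorem interior_closure_Ind (γ : SignedCardinal.{u}) :
    interior (closure (Ind H γ)) = Ind H γ := by
  refine Set.Subset.antisymm (fun A hA => ?_)
    (interior_maximal subset_closure (isOpen_Ind γ))
  refine (closure_Ind_subset (interior_subset hA)).resolve_right ?_
  rintro ⟨hU, -⟩
  obtain ⟨hif, hinf⟩ := mem_Uind_iff.1 hU
  have hle : ∀ n : ℕ, (SignedCardinal.ofCardinal (n : Cardinal.{u})).abs ≤ minIndex A := by
    intro n
    rw [minIndex, hif, min_self]
    exact (add_zero _).trans_le (natCast_lt_aleph0.le.trans hinf)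
  obtain ⟨n, hn⟩ : ∃ n : ℕ, SignedCardinal.ofCardinal (n : Cardinal.{u}) ≠ γ := by
    by_contra! h
    have := congrArg SignedCardinal.posPart ((h 0).trans (h 1).symm)
    simp [SignedCardinal.ofCardinal] at this
  obtain ⟨B, hB, hB'⟩ := mem_closure_iff.1 (mem_closure_Ind hU (hle n)) _ isOpen_interior hA
  obtain ⟨C, hC, hC'⟩ := mem_closure_iff.1 (interior_subset hB) _ (isOpen_Ind _) hB'
  exact hn (hC.2.symm.trans hC'.2)

end Closure

/-! ### Connectedness of the index sets and of their boundaries. -/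

section Connected

variable [CompleteSpace H] {A B : H →L[ℂ] H} {γ : SignedCardinal.{u}}

/-- Two operators of `H` onto `H` with kernels of the same dimension differ by an invertible
factor on the right. -/
theorem exists_isUnit_mul_eq (hA : Function.Surjective A) (hB : Function.Surjective B)
    (h : hilbertDim ↥(A : H →ₗ[ℂ] H).ker = hilbertDim ↥(B : H →ₗ[ℂ] H).ker) :
    ∃ G : H →L[ℂ] H, IsUnit G ∧ A * G = B := by
  set N := (A : H →ₗ[ℂ] H).ker with hN
  set M := (B : H →ₗ[ℂ] H).ker with hM
  have hNc : IsClosed (N : Set H) := A.isClosed_ker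
  have hMc : IsClosed (M : Set H) := B.isClosed_ker
  have : CompleteSpace N := hNc.completeSpace_coe
  have : CompleteSpace M := hMc.completeSpace_coe
  have hsplit : ∀ x : H, ∃ n ∈ N, ∃ w ∈ Nᗮ, n + w = x := fun x =>
    Submodule.mem_sup.1 (by rw [Submodule.sup_orthogonal_of_hasOrthogonalProjection]; trivial)
  have hNA : ∀ n ∈ N, A n = 0 := fun n hn => hn
  have hMB : ∀ n ∈ M, B n = 0 := fun n hn => hn
  obtain ⟨U⟩ := exists_linearIsometryEquiv h.symm
  let e : ↥Nᗮ ≃L[ℂ] H := ContinuousLinearEquiv.ofBijective (A ∘L Nᗮ.subtypeL)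
    (by
      rw [Submodule.eq_bot_iff]
      intro v hv
      have hv : (v : H) ∈ N := hv
      ext
      exact inner_self_eq_zero.1 ((Submodule.mem_orthogonal _ _).1 v.2 v hv))
    (by
      rw [eq_top_iff]
      rintro y -
      obtain ⟨x, rfl⟩ := hA y
      obtain ⟨n, hn, w, hw, rfl⟩ := hsplit x
      refine ⟨⟨w, hw⟩, ?_⟩
      change A w = A (n + w)
      rw [map_add, hNA n hn, zero_add])
  have he : ∀ y, A (e.symm y) = y := fun y => e.apply_symm_apply y
  -- `G` maps the kernel of `B` isometrically onto that of `A`, and its other component inverts `A`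
  -- on `Nᗮ` after applying `B`.
  let G : H →L[ℂ] H :=
    N.subtypeL ∘L (U.toContinuousLinearEquiv : M →L[ℂ] N) ∘L M.orthogonalProjectionOnto +
      Nᗮ.subtypeL ∘L (e.symm : H →L[ℂ] ↥Nᗮ) ∘L B
  have hG : ∀ x, G x = U (M.orthogonalProjectionOnto x) + e.symm (B x) := fun x => rfl
  have hAG : ∀ x, A (G x) = B x := by
    intro x
    rw [hG, map_add, hNA _ (U _).2, zero_add, he]
  refine ⟨G, ContinuousLinearMap.isUnit_iff_bijective.2 ⟨?_, fun y => ?_⟩,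
    ContinuousLinearMap.ext hAG⟩
  · rw [injective_iff_map_eq_zero]
    intro x hx
    have hBx : B x = 0 := by rw [← hAG, hx, map_zero]
    rw [hG, hBx, map_zero, Submodule.coe_zero, add_zero, Submodule.coe_eq_zero,
      LinearIsometryEquiv.map_eq_zero_iff, Submodule.orthogonalProjectionOnto_eq_zero_iff] at hx
    exact inner_self_eq_zero.1 ((Submodule.mem_orthogonal _ _).1 hx x hBx)
  · obtain ⟨n, hn, w, hw, rfl⟩ := hsplit y
    obtain ⟨x, hx⟩ := hB (A w)
    obtain ⟨m, hm, z, hz, rfl⟩ : ∃ m ∈ M, ∃ z ∈ Mᗮ, m + z = x :=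
      Submodule.mem_sup.1 (by rw [Submodule.sup_orthogonal_of_hasOrthogonalProjection]; trivial)
    rw [map_add, hMB m hm, zero_add] at hx
    refine ⟨U.symm ⟨n, hn⟩ + z, ?_⟩
    have h1 : M.orthogonalProjectionOnto z = 0 :=
      Submodule.orthogonalProjectionOnto_eq_zero_iff.2 hz
    have h2 : e.symm (A w) = ⟨w, hw⟩ := e.symm_apply_apply ⟨w, hw⟩
    rw [hG, map_add M.orthogonalProjectionOnto, map_add B, h1, add_zero, hMB _ (U.symm _).2, zero_add, hx, h2,
      Submodule.orthogonalProjectionOnto_mem_subspace_eq_self, U.apply_symm_apply]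

theorem joinedIn_Ind_of_surjective (hγ : γ.negPart = 0) (hA : Function.Surjective A)
    (hB : Function.Surjective B) (hkA : hilbertDim ↥(A : H →ₗ[ℂ] H).ker = γ.posPart)
    (hkB : hilbertDim ↥(B : H →ₗ[ℂ] H).ker = γ.posPart) : JoinedIn (Ind H γ) A B := by
  obtain ⟨G, hG, rfl⟩ := exists_isUnit_mul_eq hA hB (hkA.trans hkB.symm)
  have h := (joinedIn_one_of_isUnit hG).map_continuousOn (f := fun G => A * G) (by fun_prop)
  rw [mul_one] at h
  refine h.mono ?_
  rintro _ ⟨G, hG, rfl⟩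
  have hb := ContinuousLinearMap.isUnit_iff_bijective.1 hG
  refine mem_Ind_of_surjective hγ (hA.comp hb.2) ?_
  rw [← hkA]
  have : CompleteSpace (A : H →ₗ[ℂ] H).ker := A.isClosed_ker.completeSpace_coe
  have : CompleteSpace ((A * G : H →L[ℂ] H) : H →ₗ[ℂ] H).ker :=
    (A * G).isClosed_ker.completeSpace_coe
  let T : ((A * G : H →L[ℂ] H) : H →ₗ[ℂ] H).ker →L[ℂ] (A : H →ₗ[ℂ] H).ker :=
    (G ∘L Submodule.subtypeL _).codRestrict _ fun x => x.2
  refine hilbertDim_eq_of_bijective T ⟨fun x y hxy => ?_, ?_⟩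
  · exact Subtype.ext (hb.1 (congrArg Subtype.val hxy))
  · rintro ⟨y, hy⟩
    obtain ⟨x, rfl⟩ := hb.2 y
    exact ⟨⟨x, hy⟩, rfl⟩

/-- The whole segment from `A` to its surjective modification agrees with `A` on `V`, so the
codimensions, and with them the index, stay constant. -/
theorem exists_joinedIn_Ind_surjective (hγ : γ.negPart = 0) (hA : A ∈ Ind H γ) :
    ∃ B : H →L[ℂ] H, Function.Surjective B ∧ hilbertDim ↥(B : H →ₗ[ℂ] H).ker = γ.posPart ∧
      JoinedIn (Ind H γ) A B := by
  obtain ⟨hd, rfl⟩ := hA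
  obtain ⟨V, hV, ⟨c, hc, hA⟩, h1, h2⟩ := hasCodims_indices A
  have : CompleteSpace V := hV.completeSpace_coe
  have hdim : hilbertDim ↥Vᗮ =
      hilbertDim ↥(V.map (A : H →ₗ[ℂ] H))ᗮ + (index A).posPart := by
    rw [h1, h2]
    exact eq_add_posPart_difference hd hγ
  obtain ⟨C, hCV, hC⟩ := exists_surjective_modification hV hc hA hdim
  obtain ⟨hsurj, hker⟩ := hC 1 one_ne_zero
  refine ⟨_, hsurj, hker, JoinedIn.of_segment_subset ?_⟩
  rintro _ ⟨s, t, -, -, hst, rfl⟩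
  have hagree : ∀ v ∈ V,
      (s • A + t • (A ∘L V.starProjection + (1 : ℝ) • C) : H →L[ℂ] H) v = A v := by
    intro v hv
    change s • A v + t • (A (V.starProjection v) + (1 : ℝ) • C v) = A v
    rw [Submodule.starProjection_eq_self_iff.2 hv, hCV v hv, smul_zero, add_zero, ← add_smul, hst,
      one_smul]
  refine HasCodims.mem_Ind (a := initialIndex A) (b := finalIndex A)
    ⟨V, hV, ⟨c, hc, fun v hv => ?_⟩, h1, ?_⟩ hd
  · rw [hagree v hv]
    exact hA v hv
  · rw [← h2]
    have : V.map ((s • A + t • (A ∘L V.starProjection + (1 : ℝ) • C) : H →L[ℂ] H) : H →ₗ[ℂ] H)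
        = V.map (A : H →ₗ[ℂ] H) := by
      ext y
      constructor
      · rintro ⟨v, hv, rfl⟩
        exact ⟨v, hv, (hagree v hv).symm⟩
      · rintro ⟨v, hv, rfl⟩
        exact ⟨v, hv, hagree v hv⟩
    rw [this]

theorem isConnected_Ind_of_negPart_eq_zero (hH : ¬ FiniteDimensional ℂ H) (hγ : γ.negPart = 0)
    (hle : γ.posPart ≤ hilbertDim H) : IsConnected (Ind H γ) := by
  obtain ⟨A, hA, hker⟩ := exists_surjective_hilbertDim_ker (E := H) (F := H)
    (add_eq_left (aleph0_le_hilbertDim hH) hle).symm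
  refine IsPathConnected.isConnected ⟨A, mem_Ind_of_surjective hγ hA hker, fun B hB => ?_⟩
  obtain ⟨B', hB', hker', hj⟩ := exists_joinedIn_Ind_surjective hγ hB
  exact (joinedIn_Ind_of_surjective hγ hA hB' hker hker').trans hj.symm

theorem isConnected_Ind (hH : ¬ FiniteDimensional ℂ H) (hle : γ.abs ≤ hilbertDim H) :
    IsConnected (Ind H γ) := by
  rcases γ.eq_zero_or with hγ | hγ
  · rw [← image_adjoint_Ind]
    refine (isConnected_Ind_of_negPart_eq_zero hH hγ ?_).image _
      (ContinuousLinearMap.adjoint (𝕜 := ℂ) (E := H) (F := H)).continuous.continuousOn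
    exact (self_le_add_left _ _).trans hle
  · exact isConnected_Ind_of_negPart_eq_zero hH hγ ((self_le_add_right _ _).trans hle)

/-- The set is star-shaped about `0`: a nonzero scalar changes neither kernel nor range, and `0`
belongs to the set because its two indices coincide and are at least `dim H`. -/
theorem isConnected_setOf_mem_Uind (hH : ¬ FiniteDimensional ℂ H) {a : Cardinal.{u}}
    (ha : a ≤ hilbertDim H) : IsConnected {A : H →L[ℂ] H | A ∈ Uind H ∧ a ≤ minIndex A} := by
  have h0 : (0 : H →L[ℂ] H) ∈ {A : H →L[ℂ] H | A ∈ Uind H ∧ a ≤ minIndex A} := by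
    have hk : ((0 : H →L[ℂ] H) : H →ₗ[ℂ] H).ker = ⊤ := LinearMap.ker_zero
    have hr : ((0 : H →L[ℂ] H) : H →ₗ[ℂ] H).range = ⊥ := LinearMap.range_zero
    have hif : initialIndex (0 : H →L[ℂ] H) = finalIndex (0 : H →L[ℂ] H) := by
      rw [initialIndex, finalIndex, hk, hr, Submodule.orthogonal_closure,
        Submodule.bot_orthogonal_eq_top]
    have htop : hilbertDim H ≤ initialIndex (0 : H →L[ℂ] H) := by
      have : CompleteSpace (⊤ : Submodule ℂ H) := isClosed_univ.completeSpace_coe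
      rw [initialIndex, hk]
      refine le_trans (hilbertDim_le_of_injective
        ((ContinuousLinearMap.id ℂ H).codRestrict ⊤ fun _ => trivial) fun x hx => ?_)
        (self_le_add_right _ _)
      exact congrArg Subtype.val hx
    refine ⟨mem_Uind_iff.2 ⟨hif, ?_⟩, ?_⟩
    · rw [← hif]
      exact (aleph0_le_hilbertDim hH).trans htop
    · rw [minIndex, ← hif, min_self]
      exact ha.trans htop
  refine (StarConvex.isPathConnected (a := (0 : H →L[ℂ] H)) ?_ h0).isConnected
  intro A hA s t _ ht _
  rw [smul_zero, zero_add]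
  rcases ht.eq_or_lt with rfl | ht
  · rwa [zero_smul]
  · obtain ⟨hr, hk⟩ := range_ker_smul ht.ne' A
    have hi : initialIndex (t • A) = initialIndex A := by rw [initialIndex, hr, hk, initialIndex]
    have hf : finalIndex (t • A) = finalIndex A := by rw [finalIndex, hr, finalIndex]
    refine ⟨?_, ?_⟩
    · rw [mem_Uind_iff, hi, hf]
      exact mem_Uind_iff.1 hA.1
    · rw [minIndex, hi, hf]
      exact hA.2

end Connected

end HilbertIndex

theorem mainTheorem3 {H : Type u} [NormedAddCommGroup H] [InnerProductSpace ℂ H] [CompleteSpace H]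
    (hH : ¬ FiniteDimensional ℂ H) (γ : HilbertIndex.SignedCardinal.{u})
    (hγ : γ.abs ≤ HilbertIndex.hilbertDim H) :
    IsConnected (HilbertIndex.Ind H γ) ∧
    IsOpen (HilbertIndex.Ind H γ) ∧
    HilbertIndex.Ind H γ = interior (closure (HilbertIndex.Ind H γ)) ∧
    IsConnected (frontier (HilbertIndex.Ind H γ)) ∧
    frontier (HilbertIndex.Ind H γ) =
      {A : H →L[ℂ] H | A ∈ HilbertIndex.Uind H ∧ γ.abs ≤ HilbertIndex.minIndex A} := by
  refine ⟨HilbertIndex.isConnected_Ind hH hγ, HilbertIndex.isOpen_Ind γ,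
    (HilbertIndex.interior_closure_Ind γ).symm, ?_, HilbertIndex.frontier_Ind γ⟩
  rw [HilbertIndex.frontier_Ind]
  exact HilbertIndex.isConnected_setOf_mem_Uind hH hγ
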